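/- Let $\mathbb D$ be a (pseudo) double category with category of objects and arrows $\mathbb D_0$, category of proarrows and cells $\mathbb D_1$, external unit functor $y\colon \mathbb D_0\to\mathbb D_1$ and external composition $\otimes$, written in diagrammatic order. Suppose that $\mathbb D$ is an equipment, with a chosen companion $f_!\colon A\to B$ and conjoint $f^*\colon B\to A$ for every arrow $f\colon A\to B$, and that $\mathbb D$ is cartesian, i.e. the double functors $\Delta\colon\mathbb D\to\mathbb D\times\mathbb D$ and $\mathbb D\to\mathbf 1$ have right adjoints in the 2-category of double categories, (pseudo) double functors and vertical transformations. The cokernel of $f\colon A\to B$ is the canonical extension cell $\xi_f\colon y_A\Rightarrow f^*\otimes f_!$, with both boundary arrows $f$. The arrow $f$ is a cover if the canonical globular cell $f^*\otimes f_!\Rightarrow y_B$ is invertible, and an inclusion if the canonical globular cell $y_A\Rightarrow f_!\otimes f^*$ is invertible. A tabulator of a proarrow $m\colon A\to B$ is an object $T$ with a cell $\tau\colon y_T\Rightarrow m$ such that every cell $\sigma\colon y_X\Rightarrow m$ equals $\tau\, y_t$ for a unique arrow $t\colon X\to T$; its legs are the source $l\colon T\to A$ and the target $r\colon T\to B$ of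 $\tau$. An inclusion $f$ is regular if $\xi_f$ is a tabulator of $f^*\otimes f_!$. Assume that $\mathbb D$ has tabulators (i.e. $y$ has a right adjoint), that $y$ is fully faithful, that for every tabulator the arrow $\langle l,r\rangle\colon T\to A\times B$ is an inclusion, and that every inclusion is regular. Then: 1. For every arrow $f\colon A\to B$ the proarrow $f^*\otimes f_!$ has a tabulator; for each such tabulator $\tau\colon y_T\Rightarrow f^*\otimes f_!$ the two legs are equal, their common value $l\colon T\to B$ is an inclusion, and the arrow $e\colon A\to T$ determined by $\tau\, y_e=\xi_f$ is a cover with $f=l e$. 2. The factorization of an arrow as a cover followed by an inclusion is unique up to unique isomorphism: if $me=m'e'$ with $e\colon A\to I$, $e'\colon A\to J$ covers and $m\colon I\to B$, $m'\colon J\to B$ inclusions, there is a unique isomorphism $i\colon I\to J$ with $ie=e'$ and $m'i=m$. 3. With $\mathcal E$ the class of covers and $\mathcal M$ the class of inclusions, $(\mathcal E,\mathcal M)$ is an orthogonal factorization system on $\mathbb D_0$: both classes contain all isomorphisms and are closed under composition, every arrow factors as an arrow of $\mathcal E$ followed by one of $\mathcal M$, and every commutative square $mp=qe$ with $e\in\mathcal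 E$ and $m\in\mathcal M$ has a unique diagonal $d$ with $de=p$ and $md=q$. -/

import Mathlib

open CategoryTheory

universe u v w z

set_option linter.unusedVariables false
set_option linter.checkUnivs false

/-- An object of the category of proarrows and cells: a proarrow with its endpoints. -/
structure Proarrow {C : Type u} (Pro : C → C → Type w) where
  {src : C}
  {tgt : C}
  pro : Pro src tgt

/-- A (pseudo) double category. `Obj` is the category of objects and arrows, `Proarrow Pro` is the
category of proarrows and cells. A cell `α : ⟨m⟩ ⟶ ⟨n⟩` has a left boundary arrow `srcMap α` and a
right boundary arrow `tgtMap α`; two cells `α`, `β` can be composed externally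
if the right boundary of `α` is the left boundary of `β`. External composition is written in
diagrammatic order; it is associative and unital up to coherent globular isomorphisms. -/
structure DblCat where
  Obj : Type u
  [cat₀ : Category.{v} Obj]
  Pro : Obj → Obj → Type w
  [cat₁ : Category.{z} (Proarrow Pro)]
  -- external source and target functors
  srcMap {M N : Proarrow Pro} (α : M ⟶ N) : M.src ⟶ N.src
  tgtMap {M N : Proarrow Pro} (α : M ⟶ N) : M.tgt ⟶ N.tgt
  srcMap_id (M : Proarrow Pro) : srcMap (𝟙 M) = 𝟙 M.src
  tgtMap_id (M : Proarrow Pro) : tgtMap (𝟙 M) = 𝟙 M.tgt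
  srcMap_comp {M N P : Proarrow Pro} (α : M ⟶ N) (β : N ⟶ P) :
    srcMap (α ≫ β) = srcMap α ≫ srcMap β
  tgtMap_comp {M N P : Proarrow Pro} (α : M ⟶ N) (β : N ⟶ P) :
    tgtMap (α ≫ β) = tgtMap α ≫ tgtMap β
  -- external units
  unit (A : Obj) : Pro A A
  unitMap {A B : Obj} (f : A ⟶ B) : Proarrow.mk (unit A) ⟶ Proarrow.mk (unit B)
  srcMap_unitMap {A B : Obj} (f : A ⟶ B) : srcMap (unitMap f) = f
  tgtMap_unitMap {A B : Obj} (f : A ⟶ B) : tgtMap (unitMap f) = f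
  unitMap_id (A : Obj) : unitMap (𝟙 A) = 𝟙 (Proarrow.mk (unit A))
  unitMap_comp {A B C : Obj} (f : A ⟶ B) (g : B ⟶ C) :
    unitMap (f ≫ g) = unitMap f ≫ unitMap g
  -- external composition
  comp {A B C : Obj} (m : Pro A B) (n : Pro B C) : Pro A C
  hcomp {A B C A' B' C' : Obj} {m : Pro A B} {n : Pro B C} {m' : Pro A' B'} {n' : Pro B' C'}
    (α : Proarrow.mk m ⟶ Proarrow.mk m') (β : Proarrow.mk n ⟶ Proarrow.mk n')
    (h : tgtMap α = srcMap β) : Proarrow.mk (comp m n) ⟶ Proarrow.mk (comp m' n')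
  srcMap_hcomp {A B C A' B' C' : Obj}
    {m : Pro A B} {n : Pro B C} {m' : Pro A' B'} {n' : Pro B' C'}
    (α : Proarrow.mk m ⟶ Proarrow.mk m') (β : Proarrow.mk n ⟶ Proarrow.mk n')
    (h : tgtMap α = srcMap β) : srcMap (hcomp α β h) = srcMap α
  tgtMap_hcomp {A B C A' B' C' : Obj}
    {m : Pro A B} {n : Pro B C} {m' : Pro A' B'} {n' : Pro B' C'}
    (α : Proarrow.mk m ⟶ Proarrow.mk m') (β : Proarrow.mk n ⟶ Proarrow.mk n')
    (h : tgtMap α = srcMap β) : tgtMap (hcomp α β h) = tgtMap β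
  hcomp_id {A B C : Obj} (m : Pro A B) (n : Pro B C) :
    hcomp (𝟙 (Proarrow.mk m)) (𝟙 (Proarrow.mk n)) ((tgtMap_id (Proarrow.mk m)).trans (srcMap_id (Proarrow.mk n)).symm)
      = 𝟙 (Proarrow.mk (comp m n))
  hcomp_comp {A B C A' B' C' A'' B'' C'' : Obj}
    {m : Pro A B} {n : Pro B C} {m' : Pro A' B'} {n' : Pro B' C'}
    {m'' : Pro A'' B''} {n'' : Pro B'' C''}
    (α : Proarrow.mk m ⟶ Proarrow.mk m') (β : Proarrow.mk n ⟶ Proarrow.mk n')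
    (α' : Proarrow.mk m' ⟶ Proarrow.mk m'') (β' : Proarrow.mk n' ⟶ Proarrow.mk n'')
    (h : tgtMap α = srcMap β) (h' : tgtMap α' = srcMap β') :
    hcomp (α ≫ α') (β ≫ β') (by rw [tgtMap_comp, srcMap_comp, h, h'])
      = hcomp α β h ≫ hcomp α' β' h'
  -- associators
  assoc {A B C D : Obj} (m : Pro A B) (n : Pro B C) (p : Pro C D) :
    Proarrow.mk (comp (comp m n) p) ≅ Proarrow.mk (comp m (comp n p))
  srcMap_assoc {A B C D : Obj} (m : Pro A B) (n : Pro B C) (p : Pro C D) :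
    srcMap (assoc m n p).hom = 𝟙 A
  tgtMap_assoc {A B C D : Obj} (m : Pro A B) (n : Pro B C) (p : Pro C D) :
    tgtMap (assoc m n p).hom = 𝟙 D
  assoc_naturality {A B C D A' B' C' D' : Obj} {m : Pro A B} {n : Pro B C} {p : Pro C D}
    {m' : Pro A' B'} {n' : Pro B' C'} {p' : Pro C' D'}
    (α : Proarrow.mk m ⟶ Proarrow.mk m') (β : Proarrow.mk n ⟶ Proarrow.mk n')
    (γ : Proarrow.mk p ⟶ Proarrow.mk p')
    (h : tgtMap α = srcMap β) (k : tgtMap β = srcMap γ) :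
    hcomp (hcomp α β h) γ ((tgtMap_hcomp α β h).trans k) ≫ (assoc m' n' p').hom
      = (assoc m n p).hom ≫ hcomp α (hcomp β γ k) (h.trans (srcMap_hcomp β γ k).symm)
  -- unitors
  leftUnitor {A B : Obj} (m : Pro A B) : Proarrow.mk (comp (unit A) m) ≅ Proarrow.mk m
  srcMap_leftUnitor {A B : Obj} (m : Pro A B) : srcMap (leftUnitor m).hom = 𝟙 A
  tgtMap_leftUnitor {A B : Obj} (m : Pro A B) : tgtMap (leftUnitor m).hom = 𝟙 B
  leftUnitor_naturality {A B A' B' : Obj} {m : Pro A B} {m' : Pro A' B'}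
    (α : Proarrow.mk m ⟶ Proarrow.mk m') :
    hcomp (unitMap (srcMap α)) α (tgtMap_unitMap _) ≫ (leftUnitor m').hom
      = (leftUnitor m).hom ≫ α
  rightUnitor {A B : Obj} (m : Pro A B) : Proarrow.mk (comp m (unit B)) ≅ Proarrow.mk m
  srcMap_rightUnitor {A B : Obj} (m : Pro A B) : srcMap (rightUnitor m).hom = 𝟙 A
  tgtMap_rightUnitor {A B : Obj} (m : Pro A B) : tgtMap (rightUnitor m).hom = 𝟙 B
  rightUnitor_naturality {A B A' B' : Obj} {m : Pro A B} {m' : Pro A' B'}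
    (α : Proarrow.mk m ⟶ Proarrow.mk m') :
    hcomp α (unitMap (tgtMap α)) (srcMap_unitMap _).symm ≫ (rightUnitor m').hom
      = (rightUnitor m).hom ≫ α
  -- coherence
  pentagon {A B C D E : Obj} (m : Pro A B) (n : Pro B C) (p : Pro C D) (q : Pro D E) :
    hcomp (assoc m n p).hom (𝟙 (Proarrow.mk q))
        ((tgtMap_assoc m n p).trans (srcMap_id (Proarrow.mk q)).symm) ≫
      (assoc m (comp n p) q).hom ≫
      hcomp (𝟙 (Proarrow.mk m)) (assoc n p q).hom
        ((tgtMap_id (Proarrow.mk m)).trans (srcMap_assoc n p q).symm)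
      = (assoc (comp m n) p q).hom ≫ (assoc m n (comp p q)).hom
  triangle {A B C : Obj} (m : Pro A B) (n : Pro B C) :
    (assoc m (unit B) n).hom ≫
      hcomp (𝟙 (Proarrow.mk m)) (leftUnitor n).hom
        ((tgtMap_id (Proarrow.mk m)).trans (srcMap_leftUnitor n).symm)
      = hcomp (rightUnitor m).hom (𝟙 (Proarrow.mk n))
        ((tgtMap_rightUnitor m).trans (srcMap_id (Proarrow.mk n)).symm)

attribute [instance] DblCat.cat₀ DblCat.cat₁

namespace DblCat

/-- The category `D₁` of proarrows and cells. -/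
abbrev Arr (D : DblCat.{u, v, w, z}) := Proarrow D.Pro

/-- A proarrow as an object of `D₁`. -/
abbrev arr (D : DblCat.{u, v, w, z}) {A B : D.Obj} (m : D.Pro A B) : D.Arr := ⟨m⟩

/-- The external unit functor `y : D₀ ⥤ D₁`. -/
abbrev y (D : DblCat.{u, v, w, z}) : D.Obj ⥤ D.Arr where
  obj A := D.arr (D.unit A)
  map f := D.unitMap f
  map_id A := D.unitMap_id A
  map_comp f g := D.unitMap_comp f g

/-- Proarrows of a product of double categories. -/
abbrev ProdPro (D E : DblCat.{u, v, w, z}) (A B : D.Obj × E.Obj) : Type w :=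
  D.Pro A.1 B.1 × E.Pro A.2 B.2

instance prodArrCategory (D E : DblCat.{u, v, w, z}) :
    Category.{z} (Proarrow (ProdPro D E)) where
  Hom M N := (D.arr M.pro.1 ⟶ D.arr N.pro.1) × (E.arr M.pro.2 ⟶ E.arr N.pro.2)
  id M := (𝟙 (D.arr M.pro.1), 𝟙 (E.arr M.pro.2))
  comp α β := (α.1 ≫ β.1, α.2 ≫ β.2)
  id_comp _ := Prod.ext (Category.id_comp _) (Category.id_comp _)
  comp_id _ := Prod.ext (Category.comp_id _) (Category.comp_id _)
  assoc _ _ _ := Prod.ext (Category.assoc _ _ _) (Category.assoc _ _ _)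

/-- The product of two double categories, with componentwise structure. -/
abbrev prod (D E : DblCat.{u, v, w, z}) : DblCat.{u, v, w, z} where
  Obj := D.Obj × E.Obj
  cat₀ := inferInstance
  Pro := ProdPro D E
  cat₁ := prodArrCategory D E
  srcMap {M N} (α : (D.arr M.pro.1 ⟶ D.arr N.pro.1) × (E.arr M.pro.2 ⟶ E.arr N.pro.2)) :=
    (D.srcMap α.1, E.srcMap α.2)
  tgtMap {M N} (α : (D.arr M.pro.1 ⟶ D.arr N.pro.1) × (E.arr M.pro.2 ⟶ E.arr N.pro.2)) :=
    (D.tgtMap α.1, E.tgtMap α.2)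
  srcMap_id M := Prod.ext (D.srcMap_id _) (E.srcMap_id _)
  tgtMap_id M := Prod.ext (D.tgtMap_id _) (E.tgtMap_id _)
  srcMap_comp α β := Prod.ext (D.srcMap_comp _ _) (E.srcMap_comp _ _)
  tgtMap_comp α β := Prod.ext (D.tgtMap_comp _ _) (E.tgtMap_comp _ _)
  unit A := (D.unit A.1, E.unit A.2)
  unitMap f := (D.unitMap f.1, E.unitMap f.2)
  srcMap_unitMap f := Prod.ext (D.srcMap_unitMap _) (E.srcMap_unitMap _)
  tgtMap_unitMap f := Prod.ext (D.tgtMap_unitMap _) (E.tgtMap_unitMap _)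
  unitMap_id A := Prod.ext (D.unitMap_id _) (E.unitMap_id _)
  unitMap_comp f g := Prod.ext (D.unitMap_comp _ _) (E.unitMap_comp _ _)
  comp m n := (D.comp m.1 n.1, E.comp m.2 n.2)
  hcomp α β h := (D.hcomp α.1 β.1 (congrArg Prod.fst h), E.hcomp α.2 β.2 (congrArg Prod.snd h))
  srcMap_hcomp α β h := Prod.ext (D.srcMap_hcomp _ _ _) (E.srcMap_hcomp _ _ _)
  tgtMap_hcomp α β h := Prod.ext (D.tgtMap_hcomp _ _ _) (E.tgtMap_hcomp _ _ _)
  hcomp_id m n := Prod.ext (D.hcomp_id _ _) (E.hcomp_id _ _)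
  hcomp_comp α β α' β' h h' :=
    Prod.ext (D.hcomp_comp _ _ _ _ _ _) (E.hcomp_comp _ _ _ _ _ _)
  assoc m n p :=
    { hom := ((D.assoc m.1 n.1 p.1).hom, (E.assoc m.2 n.2 p.2).hom)
      inv := ((D.assoc m.1 n.1 p.1).inv, (E.assoc m.2 n.2 p.2).inv)
      hom_inv_id := Prod.ext (Iso.hom_inv_id _) (Iso.hom_inv_id _)
      inv_hom_id := Prod.ext (Iso.inv_hom_id _) (Iso.inv_hom_id _) }
  srcMap_assoc m n p := Prod.ext (D.srcMap_assoc _ _ _) (E.srcMap_assoc _ _ _)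
  tgtMap_assoc m n p := Prod.ext (D.tgtMap_assoc _ _ _) (E.tgtMap_assoc _ _ _)
  assoc_naturality α β γ h k :=
    Prod.ext (D.assoc_naturality _ _ _ _ _) (E.assoc_naturality _ _ _ _ _)
  leftUnitor m :=
    { hom := ((D.leftUnitor m.1).hom, (E.leftUnitor m.2).hom)
      inv := ((D.leftUnitor m.1).inv, (E.leftUnitor m.2).inv)
      hom_inv_id := Prod.ext (Iso.hom_inv_id _) (Iso.hom_inv_id _)
      inv_hom_id := Prod.ext (Iso.inv_hom_id _) (Iso.inv_hom_id _) }
  srcMap_leftUnitor m := Prod.ext (D.srcMap_leftUnitor _) (E.srcMap_leftUnitor _)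
  tgtMap_leftUnitor m := Prod.ext (D.tgtMap_leftUnitor _) (E.tgtMap_leftUnitor _)
  leftUnitor_naturality α := Prod.ext (D.leftUnitor_naturality _) (E.leftUnitor_naturality _)
  rightUnitor m :=
    { hom := ((D.rightUnitor m.1).hom, (E.rightUnitor m.2).hom)
      inv := ((D.rightUnitor m.1).inv, (E.rightUnitor m.2).inv)
      hom_inv_id := Prod.ext (Iso.hom_inv_id _) (Iso.hom_inv_id _)
      inv_hom_id := Prod.ext (Iso.inv_hom_id _) (Iso.inv_hom_id _) }
  srcMap_rightUnitor m := Prod.ext (D.srcMap_rightUnitor _) (E.srcMap_rightUnitor _)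
  tgtMap_rightUnitor m := Prod.ext (D.tgtMap_rightUnitor _) (E.tgtMap_rightUnitor _)
  rightUnitor_naturality α := Prod.ext (D.rightUnitor_naturality _) (E.rightUnitor_naturality _)
  pentagon m n p q := Prod.ext (D.pentagon _ _ _ _) (E.pentagon _ _ _ _)
  triangle m n := Prod.ext (D.triangle _ _) (E.triangle _ _)

/-- The single object of the terminal double category. -/
inductive Pt : Type u
  | pt

/-- Proarrows of the terminal double category. -/
abbrev PtPro (_ _ : Pt.{u}) : Type w := PUnit.{w + 1}

instance ptCategory : Category.{v} Pt.{u} where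
  Hom _ _ := PUnit.{v + 1}
  id _ := PUnit.unit
  comp _ _ := PUnit.unit

instance ptArrCategory : Category.{z} (Proarrow PtPro.{u, w}) where
  Hom _ _ := PUnit.{z + 1}
  id _ := PUnit.unit
  comp _ _ := PUnit.unit

/-- The terminal double category: one object, arrow, proarrow and cell. -/
abbrev terminal : DblCat.{u, v, w, z} where
  Obj := Pt.{u}
  cat₀ := ptCategory
  Pro := PtPro.{u, w}
  cat₁ := ptArrCategory
  srcMap _ := PUnit.unit
  tgtMap _ := PUnit.unit
  srcMap_id _ := rfl
  tgtMap_id _ := rfl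
  srcMap_comp _ _ := rfl
  tgtMap_comp _ _ := rfl
  unit _ := PUnit.unit
  unitMap _ := PUnit.unit
  srcMap_unitMap _ := rfl
  tgtMap_unitMap _ := rfl
  unitMap_id _ := rfl
  unitMap_comp _ _ := rfl
  comp _ _ := PUnit.unit
  hcomp _ _ _ := PUnit.unit
  srcMap_hcomp _ _ _ := rfl
  tgtMap_hcomp _ _ _ := rfl
  hcomp_id _ _ := rfl
  hcomp_comp _ _ _ _ _ _ := rfl
  assoc _ _ _ := ⟨PUnit.unit, PUnit.unit, rfl, rfl⟩
  srcMap_assoc _ _ _ := rfl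
  tgtMap_assoc _ _ _ := rfl
  assoc_naturality _ _ _ _ _ := rfl
  leftUnitor _ := ⟨PUnit.unit, PUnit.unit, rfl, rfl⟩
  srcMap_leftUnitor _ := rfl
  tgtMap_leftUnitor _ := rfl
  leftUnitor_naturality _ := rfl
  rightUnitor _ := ⟨PUnit.unit, PUnit.unit, rfl, rfl⟩
  srcMap_rightUnitor _ := rfl
  tgtMap_rightUnitor _ := rfl
  rightUnitor_naturality _ := rfl
  pentagon _ _ _ _ := rfl
  triangle _ _ := rfl

end DblCat

/-- A (pseudo) double functor. -/
structure DblFunctor (D E : DblCat.{u, v, w, z}) where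
  obj : D.Obj → E.Obj
  map {A B : D.Obj} (f : A ⟶ B) : obj A ⟶ obj B
  map_id (A : D.Obj) : map (𝟙 A) = 𝟙 (obj A)
  map_comp {A B C : D.Obj} (f : A ⟶ B) (g : B ⟶ C) : map (f ≫ g) = map f ≫ map g
  pro {A B : D.Obj} (m : D.Pro A B) : E.Pro (obj A) (obj B)
  cell {A B A' B' : D.Obj} {m : D.Pro A B} {m' : D.Pro A' B'} (α : D.arr m ⟶ D.arr m') :
    E.arr (pro m) ⟶ E.arr (pro m')
  cell_id {A B : D.Obj} (m : D.Pro A B) : cell (𝟙 (D.arr m)) = 𝟙 (E.arr (pro m))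
  cell_comp {A B A' B' A'' B'' : D.Obj} {m : D.Pro A B} {m' : D.Pro A' B'} {m'' : D.Pro A'' B''}
    (α : D.arr m ⟶ D.arr m') (β : D.arr m' ⟶ D.arr m'') : cell (α ≫ β) = cell α ≫ cell β
  srcMap_cell {A B A' B' : D.Obj} {m : D.Pro A B} {m' : D.Pro A' B'} (α : D.arr m ⟶ D.arr m') :
    E.srcMap (cell α) = map (D.srcMap α)
  tgtMap_cell {A B A' B' : D.Obj} {m : D.Pro A B} {m' : D.Pro A' B'} (α : D.arr m ⟶ D.arr m') :
    E.tgtMap (cell α) = map (D.tgtMap α)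
  unitIso (A : D.Obj) : E.arr (E.unit (obj A)) ≅ E.arr (pro (D.unit A))
  srcMap_unitIso (A : D.Obj) : E.srcMap (unitIso A).hom = 𝟙 (obj A)
  tgtMap_unitIso (A : D.Obj) : E.tgtMap (unitIso A).hom = 𝟙 (obj A)
  unitIso_naturality {A B : D.Obj} (f : A ⟶ B) :
    E.unitMap (map f) ≫ (unitIso B).hom = (unitIso A).hom ≫ cell (D.unitMap f)
  compIso {A B C : D.Obj} (m : D.Pro A B) (n : D.Pro B C) :
    E.arr (E.comp (pro m) (pro n)) ≅ E.arr (pro (D.comp m n))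
  srcMap_compIso {A B C : D.Obj} (m : D.Pro A B) (n : D.Pro B C) :
    E.srcMap (compIso m n).hom = 𝟙 (obj A)
  tgtMap_compIso {A B C : D.Obj} (m : D.Pro A B) (n : D.Pro B C) :
    E.tgtMap (compIso m n).hom = 𝟙 (obj C)
  compIso_naturality {A B C A' B' C' : D.Obj}
    {m : D.Pro A B} {n : D.Pro B C} {m' : D.Pro A' B'} {n' : D.Pro B' C'}
    (α : D.arr m ⟶ D.arr m') (β : D.arr n ⟶ D.arr n') (h : D.tgtMap α = D.srcMap β) :
    E.hcomp (cell α) (cell β) (by rw [tgtMap_cell, srcMap_cell, h]) ≫ (compIso m' n').hom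
      = (compIso m n).hom ≫ cell (D.hcomp α β h)
  map_assoc {A B C X : D.Obj} (m : D.Pro A B) (n : D.Pro B C) (p : D.Pro C X) :
    E.hcomp (compIso m n).hom (𝟙 (E.arr (pro p)))
        ((tgtMap_compIso m n).trans (E.srcMap_id (E.arr (pro p))).symm) ≫
      (compIso (D.comp m n) p).hom ≫ cell (D.assoc m n p).hom
      = (E.assoc (pro m) (pro n) (pro p)).hom ≫
        E.hcomp (𝟙 (E.arr (pro m))) (compIso n p).hom
          ((E.tgtMap_id (E.arr (pro m))).trans (srcMap_compIso n p).symm) ≫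
        (compIso m (D.comp n p)).hom
  map_leftUnitor {A B : D.Obj} (m : D.Pro A B) :
    E.hcomp (unitIso A).hom (𝟙 (E.arr (pro m)))
        ((tgtMap_unitIso A).trans (E.srcMap_id (E.arr (pro m))).symm) ≫
      (compIso (D.unit A) m).hom ≫ cell (D.leftUnitor m).hom
      = (E.leftUnitor (pro m)).hom
  map_rightUnitor {A B : D.Obj} (m : D.Pro A B) :
    E.hcomp (𝟙 (E.arr (pro m))) (unitIso B).hom
        ((E.tgtMap_id (E.arr (pro m))).trans (srcMap_unitIso B).symm) ≫
      (compIso m (D.unit B)).hom ≫ cell (D.rightUnitor m).hom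
      = (E.rightUnitor (pro m)).hom

namespace DblFunctor

/-- A double functor applied to an invertible cell. -/
abbrev cellIso {D E : DblCat.{u, v, w, z}} (F : DblFunctor D E) {A B A' B' : D.Obj}
    {m : D.Pro A B} {m' : D.Pro A' B'} (α : D.arr m ≅ D.arr m') :
    E.arr (F.pro m) ≅ E.arr (F.pro m') where
  hom := F.cell α.hom
  inv := F.cell α.inv
  hom_inv_id := by rw [← F.cell_comp, α.hom_inv_id, F.cell_id]
  inv_hom_id := by rw [← F.cell_comp, α.inv_hom_id, F.cell_id]

/-- The identity double functor. -/
abbrev id (D : DblCat.{u, v, w, z}) : DblFunctor D D where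
  obj A := A
  map f := f
  map_id _ := rfl
  map_comp _ _ := rfl
  pro m := m
  cell α := α
  cell_id _ := rfl
  cell_comp _ _ := rfl
  srcMap_cell _ := rfl
  tgtMap_cell _ := rfl
  unitIso A := Iso.refl _
  srcMap_unitIso A := D.srcMap_id _
  tgtMap_unitIso A := D.tgtMap_id _
  unitIso_naturality f := (Category.comp_id _).trans (Category.id_comp _).symm
  compIso m n := Iso.refl _
  srcMap_compIso m n := D.srcMap_id _
  tgtMap_compIso m n := D.tgtMap_id _
  compIso_naturality α β h := (Category.comp_id _).trans (Category.id_comp _).symm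
  map_assoc m n p := by simp [D.hcomp_id]
  map_leftUnitor m := by simp [D.hcomp_id]
  map_rightUnitor m := by simp [D.hcomp_id]

/-- Composition of double functors, in diagrammatic order. -/
abbrev comp {D E K : DblCat.{u, v, w, z}} (F : DblFunctor D E) (G : DblFunctor E K) :
    DblFunctor D K where
  obj A := G.obj (F.obj A)
  map f := G.map (F.map f)
  map_id A := by rw [F.map_id, G.map_id]
  map_comp f g := by rw [F.map_comp, G.map_comp]
  pro m := G.pro (F.pro m)
  cell α := G.cell (F.cell α)
  cell_id m := by rw [F.cell_id, G.cell_id]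
  cell_comp α β := by rw [F.cell_comp, G.cell_comp]
  srcMap_cell α := by rw [G.srcMap_cell, F.srcMap_cell]
  tgtMap_cell α := by rw [G.tgtMap_cell, F.tgtMap_cell]
  unitIso A := G.unitIso (F.obj A) ≪≫ G.cellIso (F.unitIso A)
  srcMap_unitIso A := by
    simp [K.srcMap_comp, G.srcMap_unitIso, G.srcMap_cell, F.srcMap_unitIso, G.map_id]
  tgtMap_unitIso A := by
    simp [K.tgtMap_comp, G.tgtMap_unitIso, G.tgtMap_cell, F.tgtMap_unitIso, G.map_id]
  unitIso_naturality f := by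
    simp only [Iso.trans_hom, Category.assoc]
    rw [← Category.assoc, G.unitIso_naturality, Category.assoc, ← G.cell_comp,
      F.unitIso_naturality, G.cell_comp]
  compIso m n := G.compIso (F.pro m) (F.pro n) ≪≫ G.cellIso (F.compIso m n)
  srcMap_compIso m n := by
    simp [K.srcMap_comp, G.srcMap_compIso, G.srcMap_cell, F.srcMap_compIso, G.map_id]
  tgtMap_compIso m n := by
    simp [K.tgtMap_comp, G.tgtMap_compIso, G.tgtMap_cell, F.tgtMap_compIso, G.map_id]
  compIso_naturality α β h := by
    simp only [Iso.trans_hom, Category.assoc]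
    rw [← Category.assoc, G.compIso_naturality _ _ (by rw [F.tgtMap_cell, F.srcMap_cell, h]),
      Category.assoc, ← G.cell_comp, F.compIso_naturality _ _ h, G.cell_comp]
  map_assoc m n p := by
    have h1 := K.hcomp_comp (G.compIso (F.pro m) (F.pro n)).hom (𝟙 (K.arr (G.pro (F.pro p))))
      (G.cell (F.compIso m n).hom) (G.cell (𝟙 (E.arr (F.pro p))))
      ((G.tgtMap_compIso _ _).trans (K.srcMap_id (K.arr (G.pro (F.pro p)))).symm)
      (by rw [G.tgtMap_cell, G.srcMap_cell, F.tgtMap_compIso, E.srcMap_id])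
    have h2 := K.hcomp_comp (𝟙 (K.arr (G.pro (F.pro m)))) (G.compIso (F.pro n) (F.pro p)).hom
      (G.cell (𝟙 (E.arr (F.pro m)))) (G.cell (F.compIso n p).hom)
      ((K.tgtMap_id (K.arr (G.pro (F.pro m)))).trans (G.srcMap_compIso _ _).symm)
      (by rw [G.tgtMap_cell, G.srcMap_cell, F.srcMap_compIso, E.tgtMap_id])
    simp only [G.cell_id, Category.comp_id] at h1 h2
    have n1 := G.compIso_naturality (F.compIso m n).hom (𝟙 (E.arr (F.pro p)))
      ((F.tgtMap_compIso _ _).trans (E.srcMap_id (E.arr (F.pro p))).symm)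
    have n2 := G.compIso_naturality (𝟙 (E.arr (F.pro m))) (F.compIso n p).hom
      ((E.tgtMap_id (E.arr (F.pro m))).trans (F.srcMap_compIso _ _).symm)
    simp only [G.cell_id] at n1 n2
    have e1 := congrArg G.cell (F.map_assoc m n p)
    simp only [G.cell_comp] at e1
    have e2 := G.map_assoc (F.pro m) (F.pro n) (F.pro p)
    simp only [Iso.trans_hom, Category.assoc]
    rw [h1, h2]
    simp only [Category.assoc]
    rw [reassoc_of% n1, e1, reassoc_of% e2, reassoc_of% n2]
  map_leftUnitor {A B} m := by
    have h1 := K.hcomp_comp (G.unitIso (F.obj A)).hom (𝟙 (K.arr (G.pro (F.pro m))))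
      (G.cell (F.unitIso A).hom) (G.cell (𝟙 (E.arr (F.pro m))))
      ((G.tgtMap_unitIso _).trans (K.srcMap_id (K.arr (G.pro (F.pro m)))).symm)
      (by rw [G.tgtMap_cell, G.srcMap_cell, F.tgtMap_unitIso, E.srcMap_id])
    simp only [G.cell_id, Category.comp_id] at h1
    have n1 := G.compIso_naturality (F.unitIso A).hom (𝟙 (E.arr (F.pro m)))
      ((F.tgtMap_unitIso _).trans (E.srcMap_id (E.arr (F.pro m))).symm)
    simp only [G.cell_id] at n1
    have e1 := congrArg G.cell (F.map_leftUnitor m)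
    simp only [G.cell_comp] at e1
    simp only [Iso.trans_hom, Category.assoc]
    rw [h1]
    simp only [Category.assoc]
    rw [reassoc_of% n1, e1, G.map_leftUnitor]
  map_rightUnitor {A B} m := by
    have h1 := K.hcomp_comp (𝟙 (K.arr (G.pro (F.pro m)))) (G.unitIso (F.obj B)).hom
      (G.cell (𝟙 (E.arr (F.pro m)))) (G.cell (F.unitIso B).hom)
      ((K.tgtMap_id (K.arr (G.pro (F.pro m)))).trans (G.srcMap_unitIso _).symm)
      (by rw [G.tgtMap_cell, G.srcMap_cell, F.srcMap_unitIso, E.tgtMap_id])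
    simp only [G.cell_id, Category.comp_id] at h1
    have n1 := G.compIso_naturality (𝟙 (E.arr (F.pro m))) (F.unitIso B).hom
      ((E.tgtMap_id (E.arr (F.pro m))).trans (F.srcMap_unitIso _).symm)
    simp only [G.cell_id] at n1
    have e1 := congrArg G.cell (F.map_rightUnitor m)
    simp only [G.cell_comp] at e1
    simp only [Iso.trans_hom, Category.assoc]
    rw [h1]
    simp only [Category.assoc]
    rw [reassoc_of% n1, e1, G.map_rightUnitor]

/-- The diagonal double functor. -/
abbrev diag (D : DblCat.{u, v, w, z}) : DblFunctor D (D.prod D) where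
  obj A := (A, A)
  map f := (f, f)
  map_id _ := rfl
  map_comp _ _ := rfl
  pro m := (m, m)
  cell α := (α, α)
  cell_id _ := rfl
  cell_comp _ _ := rfl
  srcMap_cell _ := rfl
  tgtMap_cell _ := rfl
  unitIso A := Iso.refl _
  srcMap_unitIso A := (D.prod D).srcMap_id _
  tgtMap_unitIso A := (D.prod D).tgtMap_id _
  unitIso_naturality f := (Category.comp_id _).trans (Category.id_comp _).symm
  compIso m n := Iso.refl _
  srcMap_compIso m n := (D.prod D).srcMap_id _
  tgtMap_compIso m n := (D.prod D).tgtMap_id _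
  compIso_naturality α β h := (Category.comp_id _).trans (Category.id_comp _).symm
  map_assoc m n p := by
    refine Prod.ext ?_ ?_ <;> exact (DblFunctor.id D).map_assoc m n p
  map_leftUnitor m := by
    refine Prod.ext ?_ ?_ <;> exact (DblFunctor.id D).map_leftUnitor m
  map_rightUnitor m := by
    refine Prod.ext ?_ ?_ <;> exact (DblFunctor.id D).map_rightUnitor m

/-- The unique double functor to the terminal double category. -/
abbrev toTerminal (D : DblCat.{u, v, w, z}) : DblFunctor D DblCat.terminal.{u, v, w, z} where
  obj _ := DblCat.Pt.pt
  map _ := PUnit.unit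
  map_id _ := rfl
  map_comp _ _ := rfl
  pro _ := PUnit.unit
  cell _ := PUnit.unit
  cell_id _ := rfl
  cell_comp _ _ := rfl
  srcMap_cell _ := rfl
  tgtMap_cell _ := rfl
  unitIso _ := Iso.refl _
  srcMap_unitIso _ := rfl
  tgtMap_unitIso _ := rfl
  unitIso_naturality _ := rfl
  compIso _ _ := Iso.refl _
  srcMap_compIso _ _ := rfl
  tgtMap_compIso _ _ := rfl
  compIso_naturality _ _ _ := rfl
  map_assoc _ _ _ := rfl
  map_leftUnitor _ := rfl
  map_rightUnitor _ := rfl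

end DblFunctor

/-- A (vertical) transformation of double functors. -/
structure DblTrans {D E : DblCat.{u, v, w, z}} (F G : DblFunctor D E) where
  app (A : D.Obj) : F.obj A ⟶ G.obj A
  naturality {A B : D.Obj} (f : A ⟶ B) : F.map f ≫ app B = app A ≫ G.map f
  cell {A B : D.Obj} (m : D.Pro A B) : E.arr (F.pro m) ⟶ E.arr (G.pro m)
  srcMap_cell {A B : D.Obj} (m : D.Pro A B) : E.srcMap (cell m) = app A
  tgtMap_cell {A B : D.Obj} (m : D.Pro A B) : E.tgtMap (cell m) = app B
  cell_naturality {A B A' B' : D.Obj} {m : D.Pro A B} {m' : D.Pro A' B'}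
    (α : D.arr m ⟶ D.arr m') : F.cell α ≫ cell m' = cell m ≫ G.cell α
  cell_unit (A : D.Obj) :
    (F.unitIso A).hom ≫ cell (D.unit A) = E.unitMap (app A) ≫ (G.unitIso A).hom
  cell_comp {A B C : D.Obj} (m : D.Pro A B) (n : D.Pro B C) :
    (F.compIso m n).hom ≫ cell (D.comp m n)
      = E.hcomp (cell m) (cell n) ((tgtMap_cell m).trans (srcMap_cell n).symm) ≫
        (G.compIso m n).hom

/-- An adjunction `F ⊣ G` in the 2-category of double categories, double functors and
transformations: a unit and a counit that satisfy the triangle identities. -/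
structure DblAdjunction {D E : DblCat.{u, v, w, z}} (F : DblFunctor D E) (G : DblFunctor E D) where
  unit : DblTrans (DblFunctor.id D) (F.comp G)
  counit : DblTrans (G.comp F) (DblFunctor.id E)
  left_triangle_app (A : D.Obj) : F.map (unit.app A) ≫ counit.app (F.obj A) = 𝟙 (F.obj A)
  left_triangle_cell {A B : D.Obj} (m : D.Pro A B) :
    F.cell (unit.cell m) ≫ counit.cell (F.pro m) = 𝟙 (E.arr (F.pro m))
  right_triangle_app (X : E.Obj) : unit.app (G.obj X) ≫ G.map (counit.app X) = 𝟙 (G.obj X)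
  right_triangle_cell {X Y : E.Obj} (p : E.Pro X Y) :
    unit.cell (G.pro p) ≫ G.cell (counit.cell p) = 𝟙 (D.arr (G.pro p))

namespace DblCat

/-- A cartesian structure on a double category: right adjoints of the diagonal `D → D × D` and of
`D → 1` in the 2-category of double categories. -/
structure Cartesian (D : DblCat.{u, v, w, z}) where
  prod : DblFunctor (D.prod D) D
  prodAdj : DblAdjunction (DblFunctor.diag D) prod
  one : DblFunctor terminal.{u, v, w, z} D
  oneAdj : DblAdjunction (DblFunctor.toTerminal D) one

/-- The arrow `⟨f, g⟩ : X ⟶ A × B`. -/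
def Cartesian.pair {D : DblCat.{u, v, w, z}} (K : D.Cartesian) {X A B : D.Obj}
    (f : X ⟶ A) (g : X ⟶ B) : X ⟶ K.prod.obj (A, B) :=
  K.prodAdj.unit.app X ≫
    K.prod.map (show ((X, X) : (D.prod D).Obj) ⟶ ((A, B) : (D.prod D).Obj) from (f, g))

/-- A companion `f_! : A ⇸ B` of an arrow `f : A ⟶ B`. -/
structure Companion (D : DblCat.{u, v, w, z}) {A B : D.Obj} (f : A ⟶ B) where
  pro : D.Pro A B
  η : D.arr (D.unit A) ⟶ D.arr pro
  ε : D.arr pro ⟶ D.arr (D.unit B)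
  srcMap_η : D.srcMap η = 𝟙 A
  tgtMap_η : D.tgtMap η = f
  srcMap_ε : D.srcMap ε = f
  tgtMap_ε : D.tgtMap ε = 𝟙 B
  vertical : η ≫ ε = D.unitMap f
  horizontal : (D.leftUnitor pro).inv ≫ D.hcomp η ε (tgtMap_η.trans srcMap_ε.symm) ≫
    (D.rightUnitor pro).hom = 𝟙 (D.arr pro)

/-- A conjoint `f^* : B ⇸ A` of an arrow `f : A ⟶ B`. -/
structure Conjoint (D : DblCat.{u, v, w, z}) {A B : D.Obj} (f : A ⟶ B) where
  pro : D.Pro B A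
  η : D.arr (D.unit A) ⟶ D.arr pro
  ε : D.arr pro ⟶ D.arr (D.unit B)
  srcMap_η : D.srcMap η = f
  tgtMap_η : D.tgtMap η = 𝟙 A
  srcMap_ε : D.srcMap ε = 𝟙 B
  tgtMap_ε : D.tgtMap ε = f
  vertical : η ≫ ε = D.unitMap f
  horizontal : (D.rightUnitor pro).inv ≫ D.hcomp ε η (tgtMap_ε.trans srcMap_η.symm) ≫
    (D.leftUnitor pro).hom = 𝟙 (D.arr pro)

/-- An equipment structure: a choice of a companion and a conjoint for every arrow. -/
structure Equipment (D : DblCat.{u, v, w, z}) where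
  companion {A B : D.Obj} (f : A ⟶ B) : D.Companion f
  conjoint {A B : D.Obj} (f : A ⟶ B) : D.Conjoint f

/-- `D` has tabulators: `y : D₀ ⥤ D₁` has a right adjoint. -/
def HasTabulators (D : DblCat.{u, v, w, z}) : Prop := D.y.IsLeftAdjoint

/-- The cell `τ : y_T ⟶ m` exhibits `T` as the tabulator of `m`, i.e. it is a universal arrow from
`y` to `m`, as is the counit at `m` of an adjunction `y ⊣ ⊤`. The legs of the tabulator are
`D.srcMap τ` and `D.tgtMap τ`. -/
def IsTabulator (D : DblCat.{u, v, w, z}) {T A B : D.Obj} {m : D.Pro A B}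
    (τ : D.arr (D.unit T) ⟶ D.arr m) : Prop :=
  ∀ (X : D.Obj) (σ : D.arr (D.unit X) ⟶ D.arr m), ∃! t : X ⟶ T, D.unitMap t ≫ τ = σ

namespace Equipment

variable {D : DblCat.{u, v, w, z}} (Q : D.Equipment)

/-- The proarrow `f_! ⊗ f^*` that underlies the kernel of `f`. -/
abbrev kernelPro {A B : D.Obj} (f : A ⟶ B) : D.Pro A A :=
  D.comp (Q.companion f).pro (Q.conjoint f).pro

/-- The proarrow `f^* ⊗ f_!` that underlies the cokernel of `f`. -/
abbrev cokernelPro {A B : D.Obj} (f : A ⟶ B) : D.Pro B B :=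
  D.comp (Q.conjoint f).pro (Q.companion f).pro

/-- The kernel of `f`: the restriction cell `f_! ⊗ f^* ⟶ y_B` of `y_B` along `f` on both sides. -/
def kernelCell {A B : D.Obj} (f : A ⟶ B) : D.arr (Q.kernelPro f) ⟶ D.arr (D.unit B) :=
  D.hcomp (Q.companion f).ε (Q.conjoint f).ε
    ((Q.companion f).tgtMap_ε.trans (Q.conjoint f).srcMap_ε.symm) ≫ (D.leftUnitor (D.unit B)).hom

/-- The cokernel of `f`: the extension cell `y_A ⟶ f^* ⊗ f_!` of `y_A` along `f` on both sides. -/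
def cokernelCell {A B : D.Obj} (f : A ⟶ B) : D.arr (D.unit A) ⟶ D.arr (Q.cokernelPro f) :=
  (D.leftUnitor (D.unit A)).inv ≫ D.hcomp (Q.conjoint f).η (Q.companion f).η
    ((Q.conjoint f).tgtMap_η.trans (Q.companion f).srcMap_η.symm)

/-- The canonical globular cell `f^* ⊗ f_! ⟶ y_B`, whose composite with the cokernel cell
is `y_f`. -/
def coverCell {A B : D.Obj} (f : A ⟶ B) : D.arr (Q.cokernelPro f) ⟶ D.arr (D.unit B) :=
  D.hcomp (Q.conjoint f).ε (Q.companion f).ε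
    ((Q.conjoint f).tgtMap_ε.trans (Q.companion f).srcMap_ε.symm) ≫ (D.leftUnitor (D.unit B)).hom

/-- The canonical globular cell `y_A ⟶ f_! ⊗ f^*`, whose composite with the kernel cell
is `y_f`. -/
def inclusionCell {A B : D.Obj} (f : A ⟶ B) : D.arr (D.unit A) ⟶ D.arr (Q.kernelPro f) :=
  (D.leftUnitor (D.unit A)).inv ≫ D.hcomp (Q.companion f).η (Q.conjoint f).η
    ((Q.companion f).tgtMap_η.trans (Q.conjoint f).srcMap_η.symm)

/-- The class of covers: arrows with trivial cokernel. -/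
def covers : MorphismProperty D.Obj := fun _ _ f => IsIso (Q.coverCell f)

/-- The class of inclusions: arrows with trivial kernel. -/
def inclusions : MorphismProperty D.Obj := fun _ _ f => IsIso (Q.inclusionCell f)

/-- An inclusion is regular if it is the tabulator of its cokernel: the cokernel cell, both of
whose boundary arrows are the inclusion itself, is a tabulator cell. -/
def IsRegularInclusion {A B : D.Obj} (f : A ⟶ B) : Prop :=
  Q.inclusions f ∧ D.IsTabulator (Q.cokernelCell f)

end Equipment

end DblCat

/-- An orthogonal factorization system: both classes contain the isomorphisms and are closed under
composition, every arrow factors as an arrow of `E` followed by one of `M`, and every commutative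
square from an arrow of `E` to an arrow of `M` has a unique diagonal filler. -/
structure IsOrthogonalFactorizationSystem {C : Type u} [Category.{v} C]
    (E M : MorphismProperty C) : Prop where
  left_iso {A B : C} (f : A ⟶ B) [IsIso f] : E f
  right_iso {A B : C} (f : A ⟶ B) [IsIso f] : M f
  left_comp {A B X : C} (f : A ⟶ B) (g : B ⟶ X) : E f → E g → E (f ≫ g)
  right_comp {A B X : C} (f : A ⟶ B) (g : B ⟶ X) : M f → M g → M (f ≫ g)
  factor {A B : C} (f : A ⟶ B) : ∃ (I : C) (e : A ⟶ I) (m : I ⟶ B), E e ∧ M m ∧ e ≫ m = f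
  lift {A B X Y : C} (e : A ⟶ X) (m : B ⟶ Y) (p : A ⟶ B) (q : X ⟶ Y) :
    E e → M m → p ≫ m = e ≫ q → ∃! d : X ⟶ B, e ≫ d = p ∧ d ≫ m = q

/-! The argument replaces invertibility of globular cells by universal properties. The kernel cell
of `f` is cartesian and the cokernel cell is opcartesian, and `y_f` factors through each of them by
a globular cell. Hence `f` is an inclusion exactly when `y_f` is cartesian (`inclusions_iff`) and a
cover exactly when `y_f` is opcartesian (`covers_iff`). Closure under composition and the case of
isomorphisms are then formal.

Fullness of `y` says that every cell between units is some `y_h`; so its two boundary arrows agree,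
and a globular endocell of a unit is an identity. This makes inclusions monic (`inclusions.mono`).
It also makes the legs of a tabulator `τ` of `f^* ⊗ f_!` equal, by composing `τ` with the globular
cell to `y_B`. If `l` is the common leg, `⟨l, l⟩` is `l` followed by the diagonal, which is split
monic, so `l` inherits the inclusion property from `⟨l, l⟩`.

The main point is that the induced `e` is a cover (`covers_of_unitMap_comp_eq`). Since `l` is an
inclusion, extending `e^* ⊗ e_!` along `l` on both sides is a cartesian cell as well as an
opcartesian one. The opcartesian property of the cokernel of `f = e ≫ l` gives a cell from `f^* ⊗
f_!` to this extension. Precomposing it with `τ` and lifting through the cartesian cell gives a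
globular `κ : y_T ⟶ e^* ⊗ e_!`, inverse to the cover cell of `e`.

For orthogonality (`IsRegularInclusion.existsUnique_lift`), a commutative square induces a cell from
a unit to the cokernel proarrow of `m`, because `y_e` is opcartesian; regularity turns that cell
into a diagonal. Monicity of `m` gives the remaining identity and uniqueness, and the uniqueness of
factorizations follows. -/

namespace DblCat

variable {D : DblCat.{u, v, w, z}}

/-! ### Coherence of unitors and associators. -/

section Coherence

variable {A B C X A' B' C' : D.Obj}

lemma srcMap_inv {m n : D.Pro A B} (i : D.arr m ≅ D.arr n) (h : D.srcMap i.hom = 𝟙 A) :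
    D.srcMap i.inv = 𝟙 A := by
  have := D.srcMap_comp i.hom i.inv
  rw [i.hom_inv_id, D.srcMap_id, h] at this
  simpa using this.symm

lemma tgtMap_inv {m n : D.Pro A B} (i : D.arr m ≅ D.arr n) (h : D.tgtMap i.hom = 𝟙 B) :
    D.tgtMap i.inv = 𝟙 B := by
  have := D.tgtMap_comp i.hom i.inv
  rw [i.hom_inv_id, D.tgtMap_id, h] at this
  simpa using this.symm

lemma srcMap_leftUnitor_inv (m : D.Pro A B) : D.srcMap (D.leftUnitor m).inv = 𝟙 A :=
  srcMap_inv _ (D.srcMap_leftUnitor m)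

lemma tgtMap_leftUnitor_inv (m : D.Pro A B) : D.tgtMap (D.leftUnitor m).inv = 𝟙 B :=
  tgtMap_inv _ (D.tgtMap_leftUnitor m)

lemma srcMap_rightUnitor_inv (m : D.Pro A B) : D.srcMap (D.rightUnitor m).inv = 𝟙 A :=
  srcMap_inv _ (D.srcMap_rightUnitor m)

lemma tgtMap_rightUnitor_inv (m : D.Pro A B) : D.tgtMap (D.rightUnitor m).inv = 𝟙 B :=
  tgtMap_inv _ (D.tgtMap_rightUnitor m)

/-- Interchange. -/
lemma hcomp_comp_hcomp {A'' B'' C'' : D.Obj}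
    {m : D.Pro A B} {n : D.Pro B C} {m' : D.Pro A' B'} {n' : D.Pro B' C'}
    {m'' : D.Pro A'' B''} {n'' : D.Pro B'' C''}
    (α : D.arr m ⟶ D.arr m') (β : D.arr n ⟶ D.arr n')
    (α' : D.arr m' ⟶ D.arr m'') (β' : D.arr n' ⟶ D.arr n'')
    (h : D.tgtMap α = D.srcMap β) (h' : D.tgtMap α' = D.srcMap β') :
    D.hcomp α β h ≫ D.hcomp α' β' h' = D.hcomp (α ≫ α') (β ≫ β')
      (by rw [D.tgtMap_comp, D.srcMap_comp, h, h']) := by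
  rw [D.hcomp_comp α β α' β' h h']

/-- Naturality of the left unitor conjugates `y_A ⊗ α` into `α`, so tensoring globular cells with a
unit is faithful. -/
lemma eq_of_unit_hcomp {m m' : D.Pro A B} {α β : D.arr m ⟶ D.arr m'}
    (hα : D.srcMap α = 𝟙 A) (hβ : D.srcMap β = 𝟙 A)
    (h : D.hcomp (𝟙 (D.arr (D.unit A))) α ((D.tgtMap_id _).trans hα.symm) =
      D.hcomp (𝟙 (D.arr (D.unit A))) β ((D.tgtMap_id _).trans hβ.symm)) : α = β := by
  have h₁ := D.leftUnitor_naturality α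
  have h₂ := D.leftUnitor_naturality β
  simp only [hα, hβ, D.unitMap_id] at h₁ h₂
  rw [← cancel_epi (D.leftUnitor m).hom, ← h₁, ← h₂, h]

lemma eq_of_hcomp_unit {m m' : D.Pro A B} {α β : D.arr m ⟶ D.arr m'}
    (hα : D.tgtMap α = 𝟙 B) (hβ : D.tgtMap β = 𝟙 B)
    (h : D.hcomp α (𝟙 (D.arr (D.unit B))) (hα.trans (D.srcMap_id (D.arr (D.unit B))).symm) =
      D.hcomp β (𝟙 (D.arr (D.unit B))) (hβ.trans (D.srcMap_id (D.arr (D.unit B))).symm)) : α = β := by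
  have h₁ := D.rightUnitor_naturality α
  have h₂ := D.rightUnitor_naturality β
  simp only [hα, hβ, D.unitMap_id] at h₁ h₂
  rw [← cancel_epi (D.rightUnitor m).hom, ← h₁, ← h₂, h]

/-- External composition of globular isomorphisms is an isomorphism. -/
lemma isIso_hcomp {m m' : D.Pro A B} {n n' : D.Pro B C} (α : D.arr m ⟶ D.arr m')
    (β : D.arr n ⟶ D.arr n') [IsIso α] [IsIso β]
    (hα : D.tgtMap α = 𝟙 B) (hβ : D.srcMap β = 𝟙 B) (h : D.tgtMap α = D.srcMap β) :
    IsIso (D.hcomp α β h) := by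
  have hα' : D.tgtMap (inv α) = 𝟙 B := tgtMap_inv (asIso α) hα
  have hβ' : D.srcMap (inv β) = 𝟙 B := srcMap_inv (asIso β) hβ
  refine ⟨D.hcomp (inv α) (inv β) (hα'.trans hβ'.symm), ?_, ?_⟩
  · rw [hcomp_comp_hcomp]
    simp only [IsIso.hom_inv_id, D.hcomp_id]
  · rw [hcomp_comp_hcomp]
    simp only [IsIso.inv_hom_id, D.hcomp_id]

/-- Kelly's argument: this unit law is a consequence of the pentagon and the triangle, tested after
tensoring with one more unit on the left. -/
lemma assoc_hom_leftUnitor (m : D.Pro A B) (n : D.Pro B C) :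
    (D.assoc (D.unit A) m n).hom ≫ (D.leftUnitor (D.comp m n)).hom =
      D.hcomp (D.leftUnitor m).hom (𝟙 (D.arr n))
        ((D.tgtMap_leftUnitor m).trans (D.srcMap_id (D.arr n)).symm) := by
  have hs : D.srcMap ((D.assoc (D.unit A) m n).hom ≫ (D.leftUnitor (D.comp m n)).hom) = 𝟙 A := by
    simp [D.srcMap_comp, D.srcMap_assoc, D.srcMap_leftUnitor]
  apply eq_of_unit_hcomp hs (by rw [D.srcMap_hcomp, D.srcMap_leftUnitor])
  have h₀ : D.tgtMap (D.assoc (D.unit A) (D.unit A) m).hom = D.srcMap (𝟙 (D.arr n)) :=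
    (D.tgtMap_assoc _ _ _).trans (D.srcMap_id (D.arr n)).symm
  have := isIso_hcomp (D.assoc (D.unit A) (D.unit A) m).hom (𝟙 (D.arr n))
    (D.tgtMap_assoc _ _ _) (D.srcMap_id _) h₀
  -- These are the first two legs of the pentagon for `y_A, y_A, m, n`; after precomposition with
  -- them both sides reduce to instances of `triangle`.
  refine (cancel_epi (D.assoc (D.unit A) (D.comp (D.unit A) m) n).hom).1
    ((cancel_epi (D.hcomp (D.assoc (D.unit A) (D.unit A) m).hom (𝟙 (D.arr n)) h₀)).1 ?_)
  have e₁ := D.hcomp_comp (𝟙 (D.arr (D.unit A))) (D.assoc (D.unit A) m n).hom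
    (𝟙 (D.arr (D.unit A))) (D.leftUnitor (D.comp m n)).hom
    ((D.tgtMap_id (D.arr (D.unit A))).trans (D.srcMap_assoc _ _ _).symm)
    ((D.tgtMap_id (D.arr (D.unit A))).trans (D.srcMap_leftUnitor _).symm)
  simp only [Category.comp_id] at e₁
  have e₂ := D.pentagon (D.unit A) (D.unit A) m n
  have e₃ := D.triangle (D.unit A) (D.comp m n)
  have e₄ := D.assoc_naturality (𝟙 (D.arr (D.unit A))) (D.leftUnitor m).hom (𝟙 (D.arr n))
    ((D.tgtMap_id (D.arr (D.unit A))).trans (D.srcMap_leftUnitor _).symm)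
    ((D.tgtMap_leftUnitor m).trans (D.srcMap_id (D.arr n)).symm)
  have e₅ := D.assoc_naturality (D.rightUnitor (D.unit A)).hom (𝟙 (D.arr m)) (𝟙 (D.arr n))
    ((D.tgtMap_rightUnitor _).trans (D.srcMap_id (D.arr m)).symm)
    ((D.tgtMap_id (D.arr m)).trans (D.srcMap_id (D.arr n)).symm)
  simp only [D.hcomp_id] at e₅
  rw [e₁, reassoc_of% e₂, e₃, ← e₅, ← e₄, ← Category.assoc]
  rw [hcomp_comp_hcomp]
  simp only [D.triangle, Category.comp_id]

lemma assoc_hom_hcomp_rightUnitor (m : D.Pro A B) (n : D.Pro B C) :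
    (D.assoc m n (D.unit C)).hom ≫ D.hcomp (𝟙 (D.arr m)) (D.rightUnitor n).hom
        ((D.tgtMap_id (D.arr m)).trans (D.srcMap_rightUnitor n).symm) =
      (D.rightUnitor (D.comp m n)).hom := by
  apply eq_of_hcomp_unit
    (by simp [D.tgtMap_comp, D.tgtMap_hcomp, D.tgtMap_assoc, D.tgtMap_rightUnitor])
    (D.tgtMap_rightUnitor _)
  refine (cancel_mono (D.assoc m n (D.unit C)).hom).1 ?_
  have e₁ := D.hcomp_comp (D.assoc m n (D.unit C)).hom (𝟙 (D.arr (D.unit C)))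
    (D.hcomp (𝟙 (D.arr m)) (D.rightUnitor n).hom
        ((D.tgtMap_id (D.arr m)).trans (D.srcMap_rightUnitor n).symm)) (𝟙 (D.arr (D.unit C)))
    ((D.tgtMap_assoc _ _ _).trans (D.srcMap_id (D.arr (D.unit C))).symm)
    (((D.tgtMap_hcomp _ _ _).trans (D.tgtMap_rightUnitor n)).trans
      (D.srcMap_id (D.arr (D.unit C))).symm)
  simp only [Category.comp_id] at e₁
  have e₂ := D.pentagon m n (D.unit C) (D.unit C)
  have e₃ := D.triangle (D.comp m n) (D.unit C)
  have e₄ := D.assoc_naturality (𝟙 (D.arr m)) (D.rightUnitor n).hom (𝟙 (D.arr (D.unit C)))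
    ((D.tgtMap_id (D.arr m)).trans (D.srcMap_rightUnitor _).symm)
    ((D.tgtMap_rightUnitor n).trans (D.srcMap_id (D.arr (D.unit C))).symm)
  have e₅ := D.assoc_naturality (𝟙 (D.arr m)) (𝟙 (D.arr n)) (D.leftUnitor (D.unit C)).hom
    ((D.tgtMap_id (D.arr m)).trans (D.srcMap_id (D.arr n)).symm)
    ((D.tgtMap_id (D.arr n)).trans (D.srcMap_leftUnitor _).symm)
  simp only [D.hcomp_id] at e₅
  have e₆ := hcomp_comp_hcomp (𝟙 (D.arr m)) (D.assoc n (D.unit C) (D.unit C)).hom (𝟙 (D.arr m))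
    (D.hcomp (𝟙 (D.arr n)) (D.leftUnitor (D.unit C)).hom
      ((D.tgtMap_id (D.arr n)).trans (D.srcMap_leftUnitor _).symm))
    ((D.tgtMap_id (D.arr m)).trans (D.srcMap_assoc _ _ _).symm)
    ((D.tgtMap_id (D.arr m)).trans ((D.srcMap_hcomp _ _ _).trans (D.srcMap_id (D.arr n))).symm)
  simp only [D.triangle, Category.comp_id] at e₆
  rw [e₁, Category.assoc, e₄, ← e₃, Category.assoc, e₅, ← reassoc_of% e₂, e₆]

/-- Naturality of the left unitor at itself identifies `y_A ⊗ λ` with the left unitor of `y_A ⊗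
y_A`; the previous unit law and the triangle then compare `λ ⊗ y_A` with `ρ ⊗ y_A`. -/
lemma leftUnitor_unit_hom (A : D.Obj) :
    (D.leftUnitor (D.unit A)).hom = (D.rightUnitor (D.unit A)).hom := by
  apply eq_of_hcomp_unit (D.tgtMap_leftUnitor _) (D.tgtMap_rightUnitor _)
  rw [← assoc_hom_leftUnitor, ← D.triangle]
  have h := D.leftUnitor_naturality (D.leftUnitor (D.unit A)).hom
  simp only [D.srcMap_leftUnitor, D.unitMap_id] at h
  rw [(cancel_mono _).1 h]

end Coherence

end DblCat

/-! ### Cartesian and opcartesian cells. -/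

namespace DblCat

variable {D : DblCat.{u, v, w, z}}

section Cartesian

/-- A cell is cartesian if every cell into its codomain whose boundary arrows factor through its
own factors uniquely through it, with the prescribed boundary. -/
def IsCartesianCell (D : DblCat.{u, v, w, z}) {M N : D.Arr} (κ : M ⟶ N) : Prop :=
  ∀ (P : D.Arr) (σ : P ⟶ N) (u : P.src ⟶ M.src) (v : P.tgt ⟶ M.tgt),
    u ≫ D.srcMap κ = D.srcMap σ → v ≫ D.tgtMap κ = D.tgtMap σ →
      ∃! ρ : P ⟶ M, D.srcMap ρ = u ∧ D.tgtMap ρ = v ∧ ρ ≫ κ = σ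

/-- A cell is opcartesian if every cell out of its domain whose boundary arrows factor through its
own factors uniquely through it, with the prescribed boundary. -/
def IsOpcartesianCell (D : DblCat.{u, v, w, z}) {M N : D.Arr} (κ : M ⟶ N) : Prop :=
  ∀ (P : D.Arr) (σ : M ⟶ P) (u : N.src ⟶ P.src) (v : N.tgt ⟶ P.tgt),
    D.srcMap κ ≫ u = D.srcMap σ → D.tgtMap κ ≫ v = D.tgtMap σ →
      ∃! ρ : N ⟶ P, D.srcMap ρ = u ∧ D.tgtMap ρ = v ∧ κ ≫ ρ = σ

variable {M N P : D.Arr}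

lemma IsCartesianCell.hom_ext {κ : M ⟶ N} (h : D.IsCartesianCell κ) {ρ ρ' : P ⟶ M}
    (hs : D.srcMap ρ = D.srcMap ρ') (ht : D.tgtMap ρ = D.tgtMap ρ') (e : ρ ≫ κ = ρ' ≫ κ) :
    ρ = ρ' :=
  (h P (ρ' ≫ κ) (D.srcMap ρ') (D.tgtMap ρ') (D.srcMap_comp _ _).symm
    (D.tgtMap_comp _ _).symm).unique ⟨hs, ht, e⟩ ⟨rfl, rfl, rfl⟩

lemma IsOpcartesianCell.hom_ext {κ : M ⟶ N} (h : D.IsOpcartesianCell κ) {ρ ρ' : N ⟶ P}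
    (hs : D.srcMap ρ = D.srcMap ρ') (ht : D.tgtMap ρ = D.tgtMap ρ') (e : κ ≫ ρ = κ ≫ ρ') :
    ρ = ρ' :=
  (h P (κ ≫ ρ') (D.srcMap ρ') (D.tgtMap ρ') (D.srcMap_comp _ _).symm
    (D.tgtMap_comp _ _).symm).unique ⟨hs, ht, e⟩ ⟨rfl, rfl, rfl⟩

lemma IsCartesianCell.comp {κ : M ⟶ N} {κ' : N ⟶ P} (h : D.IsCartesianCell κ)
    (h' : D.IsCartesianCell κ') : D.IsCartesianCell (κ ≫ κ') := by
  intro R σ u v hu hv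
  rw [D.srcMap_comp, ← Category.assoc] at hu
  rw [D.tgtMap_comp, ← Category.assoc] at hv
  obtain ⟨ρ, ⟨hs, ht, e⟩, -⟩ := h' R σ _ _ hu hv
  obtain ⟨ρ', ⟨hs', ht', e'⟩, -⟩ := h R ρ u v hs.symm ht.symm
  refine ⟨ρ', ⟨hs', ht', by rw [reassoc_of% e', e]⟩, ?_⟩
  rintro τ ⟨a, b, c⟩
  refine h.hom_ext (a.trans hs'.symm) (b.trans ht'.symm) (h'.hom_ext ?_ ?_ ?_)
  · rw [D.srcMap_comp, D.srcMap_comp, a, hs']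
  · rw [D.tgtMap_comp, D.tgtMap_comp, b, ht']
  · rw [Category.assoc, c, e', e]

lemma IsOpcartesianCell.comp {κ : M ⟶ N} {κ' : N ⟶ P} (h : D.IsOpcartesianCell κ)
    (h' : D.IsOpcartesianCell κ') : D.IsOpcartesianCell (κ ≫ κ') := by
  intro R σ u v hu hv
  rw [D.srcMap_comp, Category.assoc] at hu
  rw [D.tgtMap_comp, Category.assoc] at hv
  obtain ⟨ρ, ⟨hs, ht, e⟩, -⟩ := h R σ _ _ hu hv
  obtain ⟨ρ', ⟨hs', ht', e'⟩, -⟩ := h' R ρ u v hs.symm ht.symm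
  refine ⟨ρ', ⟨hs', ht', by rw [Category.assoc, e', e]⟩, ?_⟩
  rintro τ ⟨a, b, c⟩
  refine h'.hom_ext (a.trans hs'.symm) (b.trans ht'.symm) (h.hom_ext ?_ ?_ ?_)
  · rw [D.srcMap_comp, D.srcMap_comp, a, hs']
  · rw [D.tgtMap_comp, D.tgtMap_comp, b, ht']
  · rw [← Category.assoc, c, e', e]

lemma isCartesianCell_of_isIso (κ : M ⟶ N) [IsIso κ] : D.IsCartesianCell κ := by
  intro R σ u v hu hv
  refine ⟨σ ≫ inv κ, ⟨?_, ?_, by simp⟩, ?_⟩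
  · rw [D.srcMap_comp, ← hu, Category.assoc, ← D.srcMap_comp, IsIso.hom_inv_id, D.srcMap_id,
      Category.comp_id]
  · rw [D.tgtMap_comp, ← hv, Category.assoc, ← D.tgtMap_comp, IsIso.hom_inv_id, D.tgtMap_id,
      Category.comp_id]
  · rintro τ ⟨-, -, rfl⟩
    simp

lemma isOpcartesianCell_of_isIso (κ : M ⟶ N) [IsIso κ] : D.IsOpcartesianCell κ := by
  intro R σ u v hu hv
  refine ⟨inv κ ≫ σ, ⟨?_, ?_, by simp⟩, ?_⟩
  · rw [D.srcMap_comp, ← hu, ← Category.assoc, ← D.srcMap_comp, IsIso.inv_hom_id, D.srcMap_id,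
      Category.id_comp]
  · rw [D.tgtMap_comp, ← hv, ← Category.assoc, ← D.tgtMap_comp, IsIso.inv_hom_id, D.tgtMap_id,
      Category.id_comp]
  · rintro τ ⟨-, -, rfl⟩
    simp

/-- A globular cell between the domains of cartesian cells over the same boundary is invertible. -/
lemma IsCartesianCell.isIso_of_comp {A B : D.Obj} {m m' : D.Pro A B} {j : D.arr m ⟶ D.arr m'}
    {κ : D.arr m' ⟶ N} (h : D.IsCartesianCell κ) (hs : D.srcMap j = 𝟙 A) (ht : D.tgtMap j = 𝟙 B)
    (h' : D.IsCartesianCell (j ≫ κ)) : IsIso j := by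
  obtain ⟨ρ, ⟨a, b, c⟩, -⟩ := h' _ κ (𝟙 A) (𝟙 B)
    (by rw [D.srcMap_comp, hs]; simp) (by rw [D.tgtMap_comp, ht]; simp)
  refine ⟨ρ, h'.hom_ext ?_ ?_ ?_, h.hom_ext ?_ ?_ ?_⟩
  · rw [D.srcMap_comp, hs, a, D.srcMap_id]; simp
  · rw [D.tgtMap_comp, ht, b, D.tgtMap_id]; simp
  · rw [Category.assoc, c, Category.id_comp]
  · rw [D.srcMap_comp, hs, a, D.srcMap_id]; simp
  · rw [D.tgtMap_comp, ht, b, D.tgtMap_id]; simp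
  · rw [Category.assoc, c, Category.id_comp]

lemma IsOpcartesianCell.isIso_of_comp {A B : D.Obj} {m m' : D.Pro A B} {j : D.arr m ⟶ D.arr m'}
    {κ : M ⟶ D.arr m} (h : D.IsOpcartesianCell κ) (hs : D.srcMap j = 𝟙 A)
    (ht : D.tgtMap j = 𝟙 B) (h' : D.IsOpcartesianCell (κ ≫ j)) : IsIso j := by
  obtain ⟨ρ, ⟨a, b, c⟩, -⟩ := h' _ κ (𝟙 A) (𝟙 B)
    (by rw [D.srcMap_comp, hs]; simp) (by rw [D.tgtMap_comp, ht]; simp)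
  rw [Category.assoc] at c
  refine ⟨ρ, h.hom_ext ?_ ?_ ?_, h'.hom_ext ?_ ?_ ?_⟩
  · rw [D.srcMap_comp, hs, a, D.srcMap_id]; simp
  · rw [D.tgtMap_comp, ht, b, D.tgtMap_id]; simp
  · rw [c, Category.comp_id]
  · rw [D.srcMap_comp, hs, a, D.srcMap_id]; simp
  · rw [D.tgtMap_comp, ht, b, D.tgtMap_id]; simp
  · rw [Category.assoc, reassoc_of% c, Category.comp_id]

end Cartesian

/-! ### Restriction and extension along companions and conjoints. -/

section Restriction

variable {A B C : D.Obj} {f : A ⟶ B}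

/-- The cell `f_! ⊗ n ⟶ n` that restricts `n` along `f` on the left. -/
def Companion.restrict (c : D.Companion f) (n : D.Pro B C) :
    D.arr (D.comp c.pro n) ⟶ D.arr n :=
  D.hcomp c.ε (𝟙 (D.arr n)) (c.tgtMap_ε.trans (D.srcMap_id (D.arr n)).symm) ≫
    (D.leftUnitor n).hom

/-- The cell `n ⊗ f^* ⟶ n` that restricts `n` along `f` on the right. -/
def Conjoint.restrict (c : D.Conjoint f) (n : D.Pro C B) :
    D.arr (D.comp n c.pro) ⟶ D.arr n :=
  D.hcomp (𝟙 (D.arr n)) c.ε ((D.tgtMap_id (D.arr n)).trans c.srcMap_ε.symm) ≫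
    (D.rightUnitor n).hom

/-- The cell `n ⟶ n ⊗ f_!` that extends `n` along `f` on the right. -/
def Companion.extend (c : D.Companion f) (n : D.Pro C A) :
    D.arr n ⟶ D.arr (D.comp n c.pro) :=
  (D.rightUnitor n).inv ≫
    D.hcomp (𝟙 (D.arr n)) c.η ((D.tgtMap_id (D.arr n)).trans c.srcMap_η.symm)

/-- The cell `n ⟶ f^* ⊗ n` that extends `n` along `f` on the left. -/
def Conjoint.extend (c : D.Conjoint f) (n : D.Pro A C) :
    D.arr n ⟶ D.arr (D.comp c.pro n) :=
  (D.leftUnitor n).inv ≫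
    D.hcomp c.η (𝟙 (D.arr n)) (c.tgtMap_η.trans (D.srcMap_id (D.arr n)).symm)

lemma Companion.srcMap_restrict (c : D.Companion f) (n : D.Pro B C) :
    D.srcMap (c.restrict n) = f := by
  simp [Companion.restrict, D.srcMap_comp, D.srcMap_hcomp, D.srcMap_leftUnitor, c.srcMap_ε]

lemma Companion.tgtMap_restrict (c : D.Companion f) (n : D.Pro B C) :
    D.tgtMap (c.restrict n) = 𝟙 C := by
  simp [Companion.restrict, D.tgtMap_comp, D.tgtMap_hcomp, D.tgtMap_leftUnitor, D.tgtMap_id]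

lemma Conjoint.srcMap_restrict (c : D.Conjoint f) (n : D.Pro C B) :
    D.srcMap (c.restrict n) = 𝟙 C := by
  simp [Conjoint.restrict, D.srcMap_comp, D.srcMap_hcomp, D.srcMap_rightUnitor, D.srcMap_id]

lemma Conjoint.tgtMap_restrict (c : D.Conjoint f) (n : D.Pro C B) :
    D.tgtMap (c.restrict n) = f := by
  simp [Conjoint.restrict, D.tgtMap_comp, D.tgtMap_hcomp, D.tgtMap_rightUnitor, c.tgtMap_ε]

lemma Companion.srcMap_extend (c : D.Companion f) (n : D.Pro C A) :
    D.srcMap (c.extend n) = 𝟙 C := by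
  simp [Companion.extend, D.srcMap_comp, D.srcMap_hcomp, srcMap_rightUnitor_inv, D.srcMap_id]

lemma Companion.tgtMap_extend (c : D.Companion f) (n : D.Pro C A) :
    D.tgtMap (c.extend n) = f := by
  simp [Companion.extend, D.tgtMap_comp, D.tgtMap_hcomp, tgtMap_rightUnitor_inv, c.tgtMap_η]

lemma Conjoint.srcMap_extend (c : D.Conjoint f) (n : D.Pro A C) :
    D.srcMap (c.extend n) = f := by
  simp [Conjoint.extend, D.srcMap_comp, D.srcMap_hcomp, srcMap_leftUnitor_inv, c.srcMap_η]

lemma Conjoint.tgtMap_extend (c : D.Conjoint f) (n : D.Pro A C) :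
    D.tgtMap (c.extend n) = 𝟙 C := by
  simp [Conjoint.extend, D.tgtMap_comp, D.tgtMap_hcomp, tgtMap_leftUnitor_inv, D.tgtMap_id]

lemma Companion.hcomp_η_ε (c : D.Companion f) :
    D.hcomp c.η c.ε (c.tgtMap_η.trans c.srcMap_ε.symm) ≫ (D.rightUnitor c.pro).hom =
      (D.leftUnitor c.pro).hom := by
  have := c.horizontal
  rwa [Iso.inv_comp_eq, Category.comp_id] at this

lemma Conjoint.hcomp_ε_η (c : D.Conjoint f) :
    D.hcomp c.ε c.η (c.tgtMap_ε.trans c.srcMap_η.symm) ≫ (D.leftUnitor c.pro).hom =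
      (D.rightUnitor c.pro).hom := by
  have := c.horizontal
  rwa [Iso.inv_comp_eq, Category.comp_id] at this

/-- The horizontal zigzag identity whiskered with `n`. It yields the uniqueness of factorizations
through the restriction cell. -/
lemma Companion.hcomp_η_restrict (c : D.Companion f) (n : D.Pro B C) :
    D.hcomp c.η (c.restrict n) (c.tgtMap_η.trans (c.srcMap_restrict n).symm) =
      (D.leftUnitor (D.comp c.pro n)).hom := by
  have hηε := c.tgtMap_η.trans c.srcMap_ε.symm
  have hε1 := c.tgtMap_ε.trans (D.srcMap_id (D.arr n)).symm
  have e₁ := D.hcomp_comp c.η (D.hcomp c.ε (𝟙 (D.arr n)) hε1) (𝟙 (D.arr c.pro))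
    (D.leftUnitor n).hom (hηε.trans (D.srcMap_hcomp _ _ _).symm)
    ((D.tgtMap_id (D.arr c.pro)).trans (D.srcMap_leftUnitor n).symm)
  simp only [Category.comp_id] at e₁
  have e₂ := D.assoc_naturality c.η c.ε (𝟙 (D.arr n)) hηε hε1
  have e₃ := D.triangle c.pro n
  have e₄ := hcomp_comp_hcomp (D.hcomp c.η c.ε hηε) (𝟙 (D.arr n)) (D.rightUnitor c.pro).hom
    (𝟙 (D.arr n)) ((D.tgtMap_hcomp _ _ _).trans hε1)
    ((D.tgtMap_rightUnitor c.pro).trans (D.srcMap_id (D.arr n)).symm)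
  simp only [c.hcomp_η_ε, Category.comp_id] at e₄
  rw [← cancel_epi (D.assoc _ _ _).hom, assoc_hom_leftUnitor]
  refine (congrArg (_ ≫ ·) e₁).trans ?_
  rw [← reassoc_of% e₂, e₃, e₄]

lemma Conjoint.hcomp_restrict_η (c : D.Conjoint f) (n : D.Pro C B) :
    D.hcomp (c.restrict n) c.η ((c.tgtMap_restrict n).trans c.srcMap_η.symm) =
      (D.rightUnitor (D.comp n c.pro)).hom := by
  have hεη := c.tgtMap_ε.trans c.srcMap_η.symm
  have h1ε := (D.tgtMap_id (D.arr n)).trans c.srcMap_ε.symm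
  have e₁ := D.hcomp_comp (D.hcomp (𝟙 (D.arr n)) c.ε h1ε) c.η (D.rightUnitor n).hom
    (𝟙 (D.arr c.pro)) ((D.tgtMap_hcomp _ _ _).trans hεη)
    ((D.tgtMap_rightUnitor n).trans (D.srcMap_id (D.arr c.pro)).symm)
  simp only [Category.comp_id] at e₁
  have e₂ := D.assoc_naturality (𝟙 (D.arr n)) c.ε c.η h1ε hεη
  have e₃ := D.triangle n c.pro
  have e₄ := hcomp_comp_hcomp (𝟙 (D.arr n)) (D.hcomp c.ε c.η hεη) (𝟙 (D.arr n))
    (D.leftUnitor c.pro).hom (h1ε.trans (D.srcMap_hcomp _ _ _).symm)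
    ((D.tgtMap_id (D.arr n)).trans (D.srcMap_leftUnitor c.pro).symm)
  simp only [c.hcomp_ε_η, Category.comp_id] at e₄
  refine e₁.trans ?_
  rw [← e₃, reassoc_of% e₂, e₄, assoc_hom_hcomp_rightUnitor]

/-- The zigzag identity of the conjoint whiskered with `n`, in the form that yields the uniqueness
of factorizations through the extension cell. -/
lemma Conjoint.hcomp_ε_extend (c : D.Conjoint f) (n : D.Pro A C) :
    D.hcomp c.ε (c.extend n) (c.tgtMap_ε.trans (c.srcMap_extend n).symm) ≫
      (D.leftUnitor (D.comp c.pro n)).hom = 𝟙 (D.arr (D.comp c.pro n)) := by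
  have hεη := c.tgtMap_ε.trans c.srcMap_η.symm
  have hη1 := c.tgtMap_η.trans (D.srcMap_id (D.arr n)).symm
  have e₁ := hcomp_comp_hcomp (𝟙 (D.arr c.pro)) (D.leftUnitor n).hom c.ε (c.extend n)
    ((D.tgtMap_id (D.arr c.pro)).trans (D.srcMap_leftUnitor n).symm)
    (c.tgtMap_ε.trans (c.srcMap_extend n).symm)
  simp only [Category.id_comp, Conjoint.extend, Iso.hom_inv_id_assoc] at e₁
  have e₂ := D.assoc_naturality c.ε c.η (𝟙 (D.arr n)) hεη hη1
  have e₃ := D.triangle c.pro n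
  have e₄ := hcomp_comp_hcomp (D.hcomp c.ε c.η hεη) (𝟙 (D.arr n)) (D.leftUnitor c.pro).hom
    (𝟙 (D.arr n)) ((D.tgtMap_hcomp _ _ _).trans hη1)
    ((D.tgtMap_leftUnitor c.pro).trans (D.srcMap_id (D.arr n)).symm)
  simp only [c.hcomp_ε_η, Category.comp_id] at e₄
  have := isIso_hcomp (𝟙 (D.arr c.pro)) (D.leftUnitor n).hom (D.tgtMap_id _)
    (D.srcMap_leftUnitor n) ((D.tgtMap_id (D.arr c.pro)).trans (D.srcMap_leftUnitor n).symm)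
  refine (cancel_epi (D.hcomp (𝟙 (D.arr c.pro)) (D.leftUnitor n).hom
    ((D.tgtMap_id (D.arr c.pro)).trans (D.srcMap_leftUnitor n).symm))).1
    ((cancel_epi (D.assoc c.pro (D.unit A) n).hom).1 ?_)
  simp only [Conjoint.extend]
  rw [reassoc_of% e₁, ← reassoc_of% e₂, assoc_hom_leftUnitor, e₄]
  simp only [Category.comp_id, e₃]

lemma Companion.hcomp_extend_ε (c : D.Companion f) (n : D.Pro C A) :
    D.hcomp (c.extend n) c.ε ((c.tgtMap_extend n).trans c.srcMap_ε.symm) ≫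
      (D.rightUnitor (D.comp n c.pro)).hom = 𝟙 (D.arr (D.comp n c.pro)) := by
  have hηε := c.tgtMap_η.trans c.srcMap_ε.symm
  have h1η := (D.tgtMap_id (D.arr n)).trans c.srcMap_η.symm
  have e₁ := hcomp_comp_hcomp (D.rightUnitor n).hom (𝟙 (D.arr c.pro)) (c.extend n) c.ε
    ((D.tgtMap_rightUnitor n).trans (D.srcMap_id (D.arr c.pro)).symm)
    ((c.tgtMap_extend n).trans c.srcMap_ε.symm)
  simp only [Category.id_comp, Companion.extend, Iso.hom_inv_id_assoc] at e₁
  have e₂ := D.assoc_naturality (𝟙 (D.arr n)) c.η c.ε h1η hηε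
  have e₃ := D.triangle n c.pro
  have e₄ := hcomp_comp_hcomp (𝟙 (D.arr n)) (D.hcomp c.η c.ε hηε) (𝟙 (D.arr n))
    (D.rightUnitor c.pro).hom (h1η.trans (D.srcMap_hcomp _ _ _).symm)
    ((D.tgtMap_id (D.arr n)).trans (D.srcMap_rightUnitor c.pro).symm)
  simp only [c.hcomp_η_ε, Category.comp_id] at e₄
  have := isIso_hcomp (D.rightUnitor n).hom (𝟙 (D.arr c.pro)) (D.tgtMap_rightUnitor n)
    (D.srcMap_id _) ((D.tgtMap_rightUnitor n).trans (D.srcMap_id (D.arr c.pro)).symm)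
  refine (cancel_epi (D.hcomp (D.rightUnitor n).hom (𝟙 (D.arr c.pro))
    ((D.tgtMap_rightUnitor n).trans (D.srcMap_id (D.arr c.pro)).symm))).1 ?_
  simp only [Companion.extend]
  rw [reassoc_of% e₁, ← assoc_hom_hcomp_rightUnitor, reassoc_of% e₂, e₄]
  simp only [Category.comp_id, e₃]

/-- A factorization is obtained by pasting `y_u ≫ η` to the left of `σ`. The vertical identity `η ≫
ε = y_f` shows that it works, and the horizontal one that it is the only choice. -/
theorem Companion.isCartesianCell_restrict (c : D.Companion f) (n : D.Pro B C) :
    D.IsCartesianCell (c.restrict n) := by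
  rintro ⟨m⟩ σ u v hu hv
  rw [c.srcMap_restrict] at hu
  rw [c.tgtMap_restrict] at hv
  have h₀ : D.tgtMap (D.unitMap u ≫ c.η) = D.srcMap σ := by
    rw [D.tgtMap_comp, D.tgtMap_unitMap, c.tgtMap_η, ← hu]
  refine ⟨(D.leftUnitor m).inv ≫ D.hcomp (D.unitMap u ≫ c.η) σ h₀, ⟨?_, ?_, ?_⟩, ?_⟩
  · simp [D.srcMap_comp, D.srcMap_hcomp, D.srcMap_unitMap, srcMap_leftUnitor_inv, c.srcMap_η]
  · simp [D.tgtMap_comp, D.tgtMap_hcomp, tgtMap_leftUnitor_inv, ← hv]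
  · rw [Companion.restrict, Category.assoc, ← Category.assoc (D.hcomp _ _ _), hcomp_comp_hcomp]
    have h := D.leftUnitor_naturality σ
    simp only [← hu] at h
    simp only [Category.assoc, c.vertical, ← D.unitMap_comp, Category.comp_id, h,
      Iso.inv_hom_id_assoc]
  · rintro ρ ⟨rfl, -, rfl⟩
    have e := hcomp_comp_hcomp (D.unitMap (D.srcMap ρ)) ρ c.η (c.restrict n)
      (D.tgtMap_unitMap _) (c.tgtMap_η.trans (c.srcMap_restrict n).symm)
    rw [Iso.eq_inv_comp, ← D.leftUnitor_naturality ρ, ← e, c.hcomp_η_restrict]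

theorem Conjoint.isCartesianCell_restrict (c : D.Conjoint f) (n : D.Pro C B) :
    D.IsCartesianCell (c.restrict n) := by
  rintro ⟨m⟩ σ u v hu hv
  rw [c.srcMap_restrict] at hu
  rw [c.tgtMap_restrict] at hv
  have h₀ : D.tgtMap σ = D.srcMap (D.unitMap v ≫ c.η) := by
    rw [D.srcMap_comp, D.srcMap_unitMap, c.srcMap_η, ← hv]
  refine ⟨(D.rightUnitor m).inv ≫ D.hcomp σ (D.unitMap v ≫ c.η) h₀, ⟨?_, ?_, ?_⟩, ?_⟩
  · simp [D.srcMap_comp, D.srcMap_hcomp, srcMap_rightUnitor_inv, ← hu]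
  · simp [D.tgtMap_comp, D.tgtMap_hcomp, D.tgtMap_unitMap, tgtMap_rightUnitor_inv, c.tgtMap_η]
  · rw [Conjoint.restrict, Category.assoc, ← Category.assoc (D.hcomp _ _ _), hcomp_comp_hcomp]
    have h := D.rightUnitor_naturality σ
    simp only [← hv] at h
    simp only [Category.assoc, c.vertical, ← D.unitMap_comp, Category.comp_id, h,
      Iso.inv_hom_id_assoc]
  · rintro ρ ⟨-, rfl, rfl⟩
    have e := hcomp_comp_hcomp ρ (D.unitMap (D.tgtMap ρ)) (c.restrict n) c.η
      (D.srcMap_unitMap _).symm ((c.tgtMap_restrict n).trans c.srcMap_η.symm)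
    rw [Iso.eq_inv_comp, ← D.rightUnitor_naturality ρ, ← e, c.hcomp_restrict_η]

/-- Dual to restriction: the factorization pastes `ε ≫ y_u` to the left of `σ`. -/
theorem Conjoint.isOpcartesianCell_extend (c : D.Conjoint f) (n : D.Pro A C) :
    D.IsOpcartesianCell (c.extend n) := by
  rintro ⟨m⟩ σ u v hu hv
  rw [c.srcMap_extend] at hu
  rw [c.tgtMap_extend] at hv
  have h₀ : D.tgtMap (c.ε ≫ D.unitMap u) = D.srcMap σ := by
    rw [D.tgtMap_comp, D.tgtMap_unitMap, c.tgtMap_ε, ← hu]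
  refine ⟨D.hcomp (c.ε ≫ D.unitMap u) σ h₀ ≫ (D.leftUnitor m).hom, ⟨?_, ?_, ?_⟩, ?_⟩
  · simp [D.srcMap_comp, D.srcMap_hcomp, D.srcMap_unitMap, D.srcMap_leftUnitor, c.srcMap_ε]
  · simp [D.tgtMap_comp, D.tgtMap_hcomp, D.tgtMap_leftUnitor, ← hv]
  · rw [Conjoint.extend, Category.assoc, ← Category.assoc (D.hcomp _ _ _), hcomp_comp_hcomp]
    have h := D.leftUnitor_naturality σ
    simp only [← hu] at h
    simp only [reassoc_of% c.vertical, ← D.unitMap_comp, Category.id_comp, h,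
      Iso.inv_hom_id_assoc]
  · rintro ρ ⟨rfl, -, rfl⟩
    have e := hcomp_comp_hcomp c.ε (c.extend n) (D.unitMap (D.srcMap ρ)) ρ
      (c.tgtMap_ε.trans (c.srcMap_extend n).symm) (D.tgtMap_unitMap _)
    rw [← e, Category.assoc, D.leftUnitor_naturality ρ, reassoc_of% c.hcomp_ε_extend]

theorem Companion.isOpcartesianCell_extend (c : D.Companion f) (n : D.Pro C A) :
    D.IsOpcartesianCell (c.extend n) := by
  rintro ⟨m⟩ σ u v hu hv
  rw [c.srcMap_extend] at hu
  rw [c.tgtMap_extend] at hv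
  have h₀ : D.tgtMap σ = D.srcMap (c.ε ≫ D.unitMap v) := by
    rw [D.srcMap_comp, D.srcMap_unitMap, c.srcMap_ε, ← hv]
  refine ⟨D.hcomp σ (c.ε ≫ D.unitMap v) h₀ ≫ (D.rightUnitor m).hom, ⟨?_, ?_, ?_⟩, ?_⟩
  · simp [D.srcMap_comp, D.srcMap_hcomp, D.srcMap_rightUnitor, ← hu]
  · simp [D.tgtMap_comp, D.tgtMap_hcomp, D.tgtMap_unitMap, D.tgtMap_rightUnitor, c.tgtMap_ε]
  · rw [Companion.extend, Category.assoc, ← Category.assoc (D.hcomp _ _ _), hcomp_comp_hcomp]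
    have h := D.rightUnitor_naturality σ
    simp only [← hv] at h
    simp only [reassoc_of% c.vertical, ← D.unitMap_comp, Category.id_comp, h,
      Iso.inv_hom_id_assoc]
  · rintro ρ ⟨-, rfl, rfl⟩
    have e := hcomp_comp_hcomp (c.extend n) c.ε ρ (D.unitMap (D.tgtMap ρ))
      ((c.tgtMap_extend n).trans c.srcMap_ε.symm) (D.srcMap_unitMap _).symm
    rw [← e, Category.assoc, D.rightUnitor_naturality ρ, reassoc_of% c.hcomp_extend_ε]

/-- The counit of a conjoint is cartesian. -/
theorem Conjoint.isCartesianCell_ε (c : D.Conjoint f) : D.IsCartesianCell c.ε := by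
  have h := D.leftUnitor_naturality c.ε
  simp only [c.srcMap_ε, D.unitMap_id] at h
  -- Up to a unitor, the counit is the restriction of the unit proarrow `y_B` along `f`. The two
  -- unitors of `y_B` must agree for this.
  have e : c.ε = (D.leftUnitor c.pro).inv ≫ c.restrict (D.unit B) := by
    rw [Iso.eq_inv_comp, ← h, Conjoint.restrict, leftUnitor_unit_hom]
  rw [e]
  exact (isCartesianCell_of_isIso _).comp (c.isCartesianCell_restrict _)

/-- The unit of a companion is opcartesian. -/
theorem Companion.isOpcartesianCell_η (c : D.Companion f) : D.IsOpcartesianCell c.η := by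
  have h := D.leftUnitor_naturality c.η
  simp only [c.srcMap_η, D.unitMap_id] at h
  have e : c.η = c.extend (D.unit A) ≫ (D.leftUnitor c.pro).hom := by
    rw [Companion.extend, Category.assoc, h, Iso.eq_inv_comp, leftUnitor_unit_hom]
  rw [e]
  exact (c.isOpcartesianCell_extend _).comp (isOpcartesianCell_of_isIso _)

end Restriction

end DblCat

/-! ### Kernels, cokernels and the universal characterizations of inclusions and covers. -/

namespace DblCat

namespace Equipment

variable {D : DblCat.{u, v, w, z}} (Q : D.Equipment) {A B C : D.Obj}

/-- This exhibits the kernel as two successive one-sided restrictions, each of them cartesian. -/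
lemma kernelCell_eq (f : A ⟶ B) :
    Q.kernelCell f = (Q.companion f).restrict (Q.conjoint f).pro ≫ (Q.conjoint f).ε := by
  have h := D.leftUnitor_naturality (Q.conjoint f).ε
  simp only [(Q.conjoint f).srcMap_ε, D.unitMap_id] at h
  rw [kernelCell, Companion.restrict, Category.assoc, ← h, ← Category.assoc, hcomp_comp_hcomp]
  simp only [Category.comp_id, Category.id_comp]

lemma cokernelCell_eq (f : A ⟶ B) :
    Q.cokernelCell f = (Q.companion f).η ≫ (Q.conjoint f).extend (Q.companion f).pro := by
  have h := D.leftUnitor_naturality (Q.companion f).η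
  simp only [(Q.companion f).srcMap_η, D.unitMap_id] at h
  rw [cokernelCell, Iso.inv_comp_eq, Conjoint.extend, ← reassoc_of% h, Iso.hom_inv_id_assoc,
    hcomp_comp_hcomp]
  simp only [Category.id_comp, Category.comp_id]

theorem isCartesianCell_kernelCell (f : A ⟶ B) : D.IsCartesianCell (Q.kernelCell f) := by
  rw [kernelCell_eq]
  exact ((Q.companion f).isCartesianCell_restrict _).comp (Q.conjoint f).isCartesianCell_ε

theorem isOpcartesianCell_cokernelCell (f : A ⟶ B) : D.IsOpcartesianCell (Q.cokernelCell f) := by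
  rw [cokernelCell_eq]
  exact (Q.companion f).isOpcartesianCell_η.comp ((Q.conjoint f).isOpcartesianCell_extend _)

lemma srcMap_cokernelCell (f : A ⟶ B) : D.srcMap (Q.cokernelCell f) = f := by
  simp [cokernelCell, D.srcMap_comp, D.srcMap_hcomp, srcMap_leftUnitor_inv,
    (Q.conjoint f).srcMap_η]

lemma tgtMap_cokernelCell (f : A ⟶ B) : D.tgtMap (Q.cokernelCell f) = f := by
  simp [cokernelCell, D.tgtMap_comp, D.tgtMap_hcomp, tgtMap_leftUnitor_inv,
    (Q.companion f).tgtMap_η]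

lemma srcMap_coverCell (f : A ⟶ B) : D.srcMap (Q.coverCell f) = 𝟙 B := by
  simp [coverCell, D.srcMap_comp, D.srcMap_hcomp, D.srcMap_leftUnitor, (Q.conjoint f).srcMap_ε]

lemma tgtMap_coverCell (f : A ⟶ B) : D.tgtMap (Q.coverCell f) = 𝟙 B := by
  simp [coverCell, D.tgtMap_comp, D.tgtMap_hcomp, D.tgtMap_leftUnitor, (Q.companion f).tgtMap_ε]

lemma srcMap_inclusionCell (f : A ⟶ B) : D.srcMap (Q.inclusionCell f) = 𝟙 A := by
  simp [inclusionCell, D.srcMap_comp, D.srcMap_hcomp, srcMap_leftUnitor_inv,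
    (Q.companion f).srcMap_η]

lemma tgtMap_inclusionCell (f : A ⟶ B) : D.tgtMap (Q.inclusionCell f) = 𝟙 A := by
  simp [inclusionCell, D.tgtMap_comp, D.tgtMap_hcomp, tgtMap_leftUnitor_inv,
    (Q.conjoint f).tgtMap_η]

lemma leftUnitor_inv_hcomp_unitMap (f : A ⟶ B) :
    (D.leftUnitor (D.unit A)).inv ≫ D.hcomp (D.unitMap f) (D.unitMap f)
      ((D.tgtMap_unitMap f).trans (D.srcMap_unitMap f).symm) ≫ (D.leftUnitor (D.unit B)).hom =
      D.unitMap f := by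
  have h := D.leftUnitor_naturality (D.unitMap f)
  simp only [D.srcMap_unitMap] at h
  rw [h, Iso.inv_hom_id_assoc]

lemma inclusionCell_kernelCell (f : A ⟶ B) :
    Q.inclusionCell f ≫ Q.kernelCell f = D.unitMap f := by
  rw [inclusionCell, kernelCell, Category.assoc, ← Category.assoc (D.hcomp _ _ _),
    hcomp_comp_hcomp]
  simp only [(Q.companion f).vertical, (Q.conjoint f).vertical, leftUnitor_inv_hcomp_unitMap]

lemma cokernelCell_coverCell (f : A ⟶ B) :
    Q.cokernelCell f ≫ Q.coverCell f = D.unitMap f := by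
  rw [cokernelCell, coverCell, Category.assoc, ← Category.assoc (D.hcomp _ _ _),
    hcomp_comp_hcomp]
  simp only [(Q.companion f).vertical, (Q.conjoint f).vertical, leftUnitor_inv_hcomp_unitMap]

/-- An arrow is an inclusion if and only if its unit cell is cartesian. -/
theorem inclusions_iff (f : A ⟶ B) : Q.inclusions f ↔ D.IsCartesianCell (D.unitMap f) := by
  -- `y_f` is now a globular cell followed by a cartesian one, and such a composite is cartesian
  -- exactly when the globular cell is invertible.
  rw [← Q.inclusionCell_kernelCell]
  constructor
  · intro h
    have : IsIso (Q.inclusionCell f) := h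
    exact (isCartesianCell_of_isIso _).comp (Q.isCartesianCell_kernelCell f)
  · exact (Q.isCartesianCell_kernelCell f).isIso_of_comp (Q.srcMap_inclusionCell f)
      (Q.tgtMap_inclusionCell f)

/-- An arrow is a cover if and only if its unit cell is opcartesian. -/
theorem covers_iff (f : A ⟶ B) : Q.covers f ↔ D.IsOpcartesianCell (D.unitMap f) := by
  rw [← Q.cokernelCell_coverCell]
  constructor
  · intro h
    have : IsIso (Q.coverCell f) := h
    exact (Q.isOpcartesianCell_cokernelCell f).comp (isOpcartesianCell_of_isIso _)
  · exact (Q.isOpcartesianCell_cokernelCell f).isIso_of_comp (Q.srcMap_coverCell f)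
      (Q.tgtMap_coverCell f)

/-- Extension along an inclusion on the left is cartesian. -/
theorem isCartesianCell_conjoint_extend {f : A ⟶ B} (hf : Q.inclusions f) (n : D.Pro A C) :
    D.IsCartesianCell ((Q.conjoint f).extend n) := by
  have : IsIso (Q.inclusionCell f) := hf
  set c := Q.companion f with hc
  set j := Q.conjoint f with hj
  have hηη := c.tgtMap_η.trans j.srcMap_η.symm
  have hη1 := j.tgtMap_η.trans (D.srcMap_id (D.arr n)).symm
  have hηe := c.tgtMap_η.trans (j.srcMap_extend n).symm
  have h1 := (Q.tgtMap_inclusionCell f).trans (D.srcMap_id (D.arr n)).symm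
  -- Pasting `η` of the companion onto the extension cell gives the inclusion cell whiskered with
  -- `n`, up to an associator; hence it is invertible.
  have key : D.hcomp c.η (j.extend n) hηe =
      D.hcomp (Q.inclusionCell f) (𝟙 (D.arr n)) h1 ≫ (D.assoc c.pro j.pro n).hom := by
    have hl := (D.tgtMap_leftUnitor (D.unit A)).trans (D.srcMap_id (D.arr n)).symm
    have := isIso_hcomp (D.leftUnitor (D.unit A)).hom (𝟙 (D.arr n)) (D.tgtMap_leftUnitor _)
      (D.srcMap_id _) hl
    have e₁ := hcomp_comp_hcomp (D.leftUnitor (D.unit A)).hom (𝟙 (D.arr n)) (Q.inclusionCell f)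
      (𝟙 (D.arr n)) hl h1
    simp only [inclusionCell, Iso.hom_inv_id_assoc, Category.comp_id] at e₁
    have e₂ := hcomp_comp_hcomp (𝟙 (D.arr (D.unit A))) (D.leftUnitor n).hom c.η (j.extend n)
      ((D.tgtMap_id (D.arr (D.unit A))).trans (D.srcMap_leftUnitor n).symm) hηe
    simp only [Conjoint.extend, Iso.hom_inv_id_assoc, Category.id_comp] at e₂
    have e₃ := D.triangle (D.unit A) n
    simp only [← leftUnitor_unit_hom] at e₃
    have e₄ := D.assoc_naturality c.η j.η (𝟙 (D.arr n)) hηη hη1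
    refine (cancel_epi (D.hcomp (D.leftUnitor (D.unit A)).hom (𝟙 (D.arr n)) hl)).1 ?_
    simp only [Conjoint.extend, inclusionCell]
    rw [reassoc_of% e₁, e₄, ← e₂, ← reassoc_of% e₃]
  have : IsIso (D.hcomp (Q.inclusionCell f) (𝟙 (D.arr n)) h1) :=
    isIso_hcomp _ _ (Q.tgtMap_inclusionCell f) (D.srcMap_id _) h1
  have : IsIso (D.hcomp c.η (j.extend n) hηe) := by rw [key]; infer_instance
  -- The extension cell factors as this invertible cell followed by restriction along `f`, so it is
  -- cartesian.
  have e : j.extend n = ((D.leftUnitor n).inv ≫ D.hcomp c.η (j.extend n) hηe) ≫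
      c.restrict (D.comp j.pro n) := by
    have h := D.leftUnitor_naturality (j.extend n)
    simp only [j.srcMap_extend] at h
    rw [Companion.restrict, Category.assoc, ← Category.assoc (D.hcomp _ _ _), hcomp_comp_hcomp]
    simp only [c.vertical, Category.comp_id, h, Iso.inv_hom_id_assoc]
  rw [e]
  exact (isCartesianCell_of_isIso _).comp (c.isCartesianCell_restrict _)

/-- Extension along an inclusion on the right is cartesian. -/
theorem isCartesianCell_companion_extend {f : A ⟶ B} (hf : Q.inclusions f) (n : D.Pro C A) :
    D.IsCartesianCell ((Q.companion f).extend n) := by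
  have : IsIso (Q.inclusionCell f) := hf
  set c := Q.companion f with hc
  set j := Q.conjoint f with hj
  have hηη := c.tgtMap_η.trans j.srcMap_η.symm
  have h1η := (D.tgtMap_id (D.arr n)).trans c.srcMap_η.symm
  have heη := (c.tgtMap_extend n).trans j.srcMap_η.symm
  have h1 := (D.tgtMap_id (D.arr n)).trans (Q.srcMap_inclusionCell f).symm
  have key : D.hcomp (c.extend n) j.η heη ≫ (D.assoc n c.pro j.pro).hom =
      D.hcomp (𝟙 (D.arr n)) (Q.inclusionCell f) h1 := by
    have hl := (D.tgtMap_id (D.arr n)).trans (D.srcMap_leftUnitor (D.unit A)).symm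
    have := isIso_hcomp (𝟙 (D.arr n)) (D.leftUnitor (D.unit A)).hom (D.tgtMap_id _)
      (D.srcMap_leftUnitor _) hl
    have e₁ := hcomp_comp_hcomp (𝟙 (D.arr n)) (D.leftUnitor (D.unit A)).hom (𝟙 (D.arr n))
      (Q.inclusionCell f) hl h1
    simp only [inclusionCell, Iso.hom_inv_id_assoc, Category.comp_id] at e₁
    have e₂ := hcomp_comp_hcomp (D.rightUnitor n).hom (𝟙 (D.arr (D.unit A))) (c.extend n) j.η
      ((D.tgtMap_rightUnitor n).trans (D.srcMap_id (D.arr (D.unit A))).symm) heη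
    simp only [Companion.extend, Iso.hom_inv_id_assoc, Category.id_comp] at e₂
    have e₃ := D.triangle n (D.unit A)
    have e₄ := D.assoc_naturality (𝟙 (D.arr n)) c.η j.η h1η hηη
    refine (cancel_epi (D.hcomp (𝟙 (D.arr n)) (D.leftUnitor (D.unit A)).hom hl)).1
      ((cancel_epi (D.assoc n (D.unit A) (D.unit A)).hom).1 ?_)
    simp only [Companion.extend, inclusionCell]
    rw [e₁, reassoc_of% e₃, reassoc_of% e₂, e₄]
  have : IsIso (D.hcomp (𝟙 (D.arr n)) (Q.inclusionCell f) h1) :=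
    isIso_hcomp _ _ (D.tgtMap_id _) (Q.srcMap_inclusionCell f) h1
  have : IsIso (D.hcomp (c.extend n) j.η heη) := by
    rw [← Iso.eq_comp_inv] at key
    rw [key]; infer_instance
  have e : c.extend n = ((D.rightUnitor n).inv ≫ D.hcomp (c.extend n) j.η heη) ≫
      j.restrict (D.comp n c.pro) := by
    have h := D.rightUnitor_naturality (c.extend n)
    simp only [c.tgtMap_extend] at h
    rw [Conjoint.restrict, Category.assoc, ← Category.assoc (D.hcomp _ _ _), hcomp_comp_hcomp]
    simp only [j.vertical, Category.comp_id, h, Iso.inv_hom_id_assoc]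
  rw [e]
  exact (isCartesianCell_of_isIso _).comp (j.isCartesianCell_restrict _)

end Equipment

end DblCat

/-! ### Consequences of fullness, the cover through a tabulator, and orthogonality. -/

namespace DblCat

variable {D : DblCat.{u, v, w, z}}

lemma exists_unitMap_eq (hFull : D.y.Full) {A B : D.Obj}
    (σ : D.arr (D.unit A) ⟶ D.arr (D.unit B)) : ∃ h : A ⟶ B, D.unitMap h = σ :=
  D.y.map_surjective σ

/-- If the external unit functor is full, cells between units have equal boundary arrows. -/
lemma srcMap_eq_tgtMap (hFull : D.y.Full) {A B : D.Obj}
    (σ : D.arr (D.unit A) ⟶ D.arr (D.unit B)) : D.srcMap σ = D.tgtMap σ := by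
  obtain ⟨h, rfl⟩ := exists_unitMap_eq hFull σ
  rw [D.srcMap_unitMap, D.tgtMap_unitMap]

lemma HasTabulators.exists_isTabulator (h : D.HasTabulators) {A B : D.Obj} (m : D.Pro A B) :
    ∃ (T : D.Obj) (τ : D.arr (D.unit T) ⟶ D.arr m), D.IsTabulator τ := by
  have : D.y.IsLeftAdjoint := h
  let adj := Adjunction.ofIsLeftAdjoint D.y
  refine ⟨D.y.rightAdjoint.obj (D.arr m), adj.counit.app (D.arr m), fun X σ => ?_⟩
  refine ⟨adj.homEquiv X (D.arr m) σ, ?_, fun t ht => ?_⟩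
  · exact (adj.homEquiv_counit (g := adj.homEquiv X (D.arr m) σ)).symm.trans
      (Equiv.symm_apply_apply _ _)
  · rw [← ht]
    exact ((Equiv.apply_symm_apply _ t).symm.trans (congrArg _ (adj.homEquiv_counit _ _ _)))

/-- The pairing of an arrow with itself is its composite with the diagonal. -/
lemma Cartesian.pair_self (K : D.Cartesian) {X A : D.Obj} (f : X ⟶ A) :
    K.pair f f = f ≫ K.prodAdj.unit.app A :=
  (K.prodAdj.unit.naturality f).symm

/-- The retraction of the diagonal is the first projection, a component of the counit. -/
lemma Cartesian.exists_unit_app_comp (K : D.Cartesian) (A : D.Obj) :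
    ∃ r : K.prod.obj (A, A) ⟶ A, K.prodAdj.unit.app A ≫ r = 𝟙 A :=
  ⟨(K.prodAdj.counit.app ((A, A) : (D.prod D).Obj)).1,
    congrArg Prod.fst (K.prodAdj.left_triangle_app A)⟩

namespace Equipment

variable (Q : D.Equipment) {A B C : D.Obj}

lemma inclusions_of_isIso (f : A ⟶ B) [IsIso f] : Q.inclusions f := by
  have : IsIso (D.unitMap f) := Functor.map_isIso D.y f
  exact (Q.inclusions_iff f).2 (isCartesianCell_of_isIso _)

lemma covers_of_isIso (f : A ⟶ B) [IsIso f] : Q.covers f := by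
  have : IsIso (D.unitMap f) := Functor.map_isIso D.y f
  exact (Q.covers_iff f).2 (isOpcartesianCell_of_isIso _)

lemma inclusions_comp {f : A ⟶ B} {g : B ⟶ C} (hf : Q.inclusions f) (hg : Q.inclusions g) :
    Q.inclusions (f ≫ g) := by
  rw [inclusions_iff, D.unitMap_comp]
  exact ((Q.inclusions_iff f).1 hf).comp ((Q.inclusions_iff g).1 hg)

lemma covers_comp {f : A ⟶ B} {g : B ⟶ C} (hf : Q.covers f) (hg : Q.covers g) :
    Q.covers (f ≫ g) := by
  rw [covers_iff, D.unitMap_comp]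
  exact ((Q.covers_iff f).1 hf).comp ((Q.covers_iff g).1 hg)

/-- Given `σ` into `y_B`, factor `σ ≫ y_g` through the cartesian cell `y_(f ≫ g)`; composing with
`y_r` recovers a factorization of `σ` through `y_f`. -/
lemma inclusions_of_comp {f : A ⟶ B} {g : B ⟶ C} {r : C ⟶ B} (hr : g ≫ r = 𝟙 B)
    (h : Q.inclusions (f ≫ g)) : Q.inclusions f := by
  rw [inclusions_iff] at h ⊢
  have e : D.unitMap f = D.unitMap (f ≫ g) ≫ D.unitMap r := by
    rw [← D.unitMap_comp, Category.assoc, hr, Category.comp_id]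
  intro P σ u v hu hv
  rw [D.srcMap_unitMap] at hu
  rw [D.tgtMap_unitMap] at hv
  obtain ⟨ρ, ⟨hs, ht, hρ⟩, -⟩ := h P (σ ≫ D.unitMap g) u v
    (by rw [D.srcMap_unitMap, D.srcMap_comp, D.srcMap_unitMap, ← hu, Category.assoc])
    (by rw [D.tgtMap_unitMap, D.tgtMap_comp, D.tgtMap_unitMap, ← hv, Category.assoc])
  refine ⟨ρ, ⟨hs, ht, ?_⟩, ?_⟩
  · rw [e, reassoc_of% hρ, ← D.unitMap_comp, hr, D.unitMap_id, Category.comp_id]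
  · rintro ρ' ⟨hs', ht', rfl⟩
    refine h.hom_ext (hs'.trans hs.symm) (ht'.trans ht.symm) ?_
    rw [hρ, D.unitMap_comp, Category.assoc]

variable {Q}

/-- Since `y_m` is cartesian, `y_(a ≫ m)` lifts to a cell between units with left boundary `a` and
right boundary `b`; fullness forces these to coincide. -/
lemma inclusions.mono (hFull : D.y.Full) {m : B ⟶ C} (hm : Q.inclusions m) {a b : A ⟶ B}
    (h : a ≫ m = b ≫ m) : a = b := by
  obtain ⟨ρ, ⟨hs, ht, -⟩, -⟩ := (Q.inclusions_iff m).1 hm (D.arr (D.unit A)) (D.unitMap (a ≫ m))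
    a b (by rw [D.srcMap_unitMap, D.srcMap_unitMap]) (by rw [D.tgtMap_unitMap, D.tgtMap_unitMap, h])
  rw [← hs, ← ht]
  exact srcMap_eq_tgtMap hFull ρ

/-- Composing with the globular cover cell leaves the boundary arrows unchanged and lands in a unit,
where fullness applies. -/
lemma srcMap_eq_tgtMap_of_cokernelPro (hFull : D.y.Full) {T : D.Obj} {f : A ⟶ B}
    (τ : D.arr (D.unit T) ⟶ D.arr (Q.cokernelPro f)) : D.srcMap τ = D.tgtMap τ := by
  have h := srcMap_eq_tgtMap hFull (τ ≫ Q.coverCell f)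
  rw [D.srcMap_comp, D.tgtMap_comp, srcMap_coverCell, tgtMap_coverCell] at h
  simpa using h

/-- If the cokernel cell of `f` factors as `y_e` followed by a cell whose boundary arrows are an
inclusion, then `e` is a cover. -/
theorem covers_of_unitMap_comp_eq (hFull : D.y.Full) {T : D.Obj} {f : A ⟶ B} {l : T ⟶ B}
    {e : A ⟶ T} (τ : D.arr (D.unit T) ⟶ D.arr (Q.cokernelPro f)) (hs : D.srcMap τ = l)
    (ht : D.tgtMap τ = l) (hl : Q.inclusions l) (he : D.unitMap e ≫ τ = Q.cokernelCell f) :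
    Q.covers e := by
  have hf : e ≫ l = f := by
    rw [← Q.srcMap_cokernelCell f, ← he, D.srcMap_comp, D.srcMap_unitMap, hs]
  -- `χ₁ ≫ χ₂` extends `e^* ⊗ e_!` along `l` on both sides, with target `(l^* ⊗ (e^* ⊗ e_!)) ⊗ l_!`.
  let χ₁ := (Q.conjoint l).extend (Q.cokernelPro e)
  let χ₂ := (Q.companion l).extend (D.comp (Q.conjoint l).pro (Q.cokernelPro e))
  have hχ : D.IsCartesianCell (χ₁ ≫ χ₂) :=
    (Q.isCartesianCell_conjoint_extend hl _).comp (Q.isCartesianCell_companion_extend hl _)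
  have hχs : D.srcMap (χ₁ ≫ χ₂) = l := by
    rw [D.srcMap_comp, Conjoint.srcMap_extend, Companion.srcMap_extend]
    exact Category.comp_id l
  have hχt : D.tgtMap (χ₁ ≫ χ₂) = l := by
    rw [D.tgtMap_comp, Conjoint.tgtMap_extend, Companion.tgtMap_extend]
    exact Category.id_comp l
  -- A globular comparison from `f^* ⊗ f_!` to the two-sided extension; it exists because `e ≫ l =
  -- f` makes the boundaries match.
  obtain ⟨θ, ⟨hθs, hθt, hθ⟩, -⟩ := Q.isOpcartesianCell_cokernelCell f _
    (Q.cokernelCell e ≫ χ₁ ≫ χ₂) (𝟙 B) (𝟙 B)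
    (by rw [D.srcMap_comp _ (χ₁ ≫ χ₂), hχs, srcMap_cokernelCell, srcMap_cokernelCell, hf]
        exact Category.comp_id f)
    (by rw [D.tgtMap_comp _ (χ₁ ≫ χ₂), hχt, tgtMap_cokernelCell, tgtMap_cokernelCell, hf]
        exact Category.comp_id f)
  -- Both boundaries of `τ ≫ θ` are `l`, so it lifts through the cartesian cell to a globular `κ`,
  -- the candidate inverse of the cover cell.
  obtain ⟨κ, ⟨hκs, hκt, hκ⟩, -⟩ := hχ _ (τ ≫ θ) (𝟙 T) (𝟙 T)
    (by rw [hχs, D.srcMap_comp, hs, hθs]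
        exact (Category.id_comp l).trans (Category.comp_id l).symm)
    (by rw [hχt, D.tgtMap_comp, ht, hθt]
        exact (Category.id_comp l).trans (Category.comp_id l).symm)
  have hκe : D.unitMap e ≫ κ = Q.cokernelCell e := by
    refine hχ.hom_ext ?_ ?_ ?_
    · rw [D.srcMap_comp, hκs, D.srcMap_unitMap, srcMap_cokernelCell]
      exact Category.comp_id e
    · rw [D.tgtMap_comp, hκt, D.tgtMap_unitMap, tgtMap_cokernelCell]
      exact Category.comp_id e
    · rw [Category.assoc, hκ, ← Category.assoc, he, hθ]
  refine ⟨κ, (Q.isOpcartesianCell_cokernelCell e).hom_ext ?_ ?_ ?_, ?_⟩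
  · rw [D.srcMap_comp, hκs, srcMap_coverCell, D.srcMap_id]
    exact Category.comp_id _
  · rw [D.tgtMap_comp, hκt, tgtMap_coverCell, D.tgtMap_id]
    exact Category.comp_id _
  · rw [← Category.assoc, cokernelCell_coverCell, hκe, Category.comp_id]
  -- This composite is a globular endocell of `y_T`, so by fullness it is `y_h` with `h` an
  -- identity.
  · obtain ⟨h, hh⟩ := exists_unitMap_eq hFull (κ ≫ Q.coverCell e)
    have : h = 𝟙 T := by
      rw [← D.srcMap_unitMap h, hh, D.srcMap_comp, hκs, srcMap_coverCell]
      exact Category.comp_id _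
    rw [← hh, this, D.unitMap_id]

/-- Covers are left orthogonal to regular inclusions. -/
theorem IsRegularInclusion.existsUnique_lift (hFull : D.y.Full) {X Y : D.Obj} {e : A ⟶ X}
    {m : B ⟶ Y} {p : A ⟶ B} {q : X ⟶ Y} (he : Q.covers e) (hm : Q.IsRegularInclusion m)
    (h : p ≫ m = e ≫ q) : ∃! d : X ⟶ B, e ≫ d = p ∧ d ≫ m = q := by
  -- Transporting `p` into the cokernel of `m` gives boundaries `p ≫ m = e ≫ q`, so the cell
  -- descends along `y_e` to a cell with boundaries `q`.
  obtain ⟨ω, ⟨hs, -, hω⟩, -⟩ := (Q.covers_iff e).1 he _ (D.unitMap p ≫ Q.cokernelCell m) q q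
    (by rw [D.srcMap_comp, D.srcMap_unitMap, D.srcMap_unitMap, srcMap_cokernelCell, h])
    (by rw [D.tgtMap_comp, D.tgtMap_unitMap, D.tgtMap_unitMap, tgtMap_cokernelCell, h])
  obtain ⟨d, hd, -⟩ := hm.2 X ω
  have hdm : d ≫ m = q := by
    rw [← hs, ← hd, D.srcMap_comp, D.srcMap_unitMap, srcMap_cokernelCell]
  -- Only `d ≫ m = q` comes from the tabulator; the other triangle and uniqueness are checked after
  -- composing with the monic `m`.
  refine ⟨d, ⟨hm.1.mono hFull ?_, hdm⟩, ?_⟩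
  · rw [Category.assoc, hdm, h]
  · rintro d' ⟨-, h'⟩
    exact hm.1.mono hFull (h'.trans hdm.symm)

end Equipment

end DblCat

/-! ### The factorization theorem. -/

theorem mainTheorem7 (D : DblCat.{u, v, w, z}) (Q : D.Equipment) (K : D.Cartesian)
    (hTab : D.HasTabulators) (hFull : D.y.Full) (hFaithful : D.y.Faithful)
    (hJoint : ∀ (A B T : D.Obj) (m : D.Pro A B) (τ : D.arr (D.unit T) ⟶ D.arr m),
      D.IsTabulator τ → Q.inclusions (K.pair (D.srcMap τ) (D.tgtMap τ)))
    (hReg : ∀ (A B : D.Obj) (f : A ⟶ B), Q.inclusions f → Q.IsRegularInclusion f) :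
    -- every arrow factors as a cover followed by an inclusion through the tabulator
    -- of its cokernel, which exists and has equal legs
    (∀ (A B : D.Obj) (f : A ⟶ B),
      (∃ (T : D.Obj) (τ : D.arr (D.unit T) ⟶ D.arr (Q.cokernelPro f)), D.IsTabulator τ) ∧
      ∀ (T : D.Obj) (τ : D.arr (D.unit T) ⟶ D.arr (Q.cokernelPro f)), D.IsTabulator τ →
        D.srcMap τ = D.tgtMap τ ∧ Q.inclusions (D.srcMap τ) ∧
        ∃ e : A ⟶ T, D.unitMap e ≫ τ = Q.cokernelCell f ∧
          Q.covers e ∧ e ≫ D.srcMap τ = f) ∧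
    -- such a factorization is unique up to unique isomorphism
    (∀ (A B I J : D.Obj) (e : A ⟶ I) (m : I ⟶ B) (e' : A ⟶ J) (m' : J ⟶ B),
      Q.covers e → Q.inclusions m → Q.covers e' → Q.inclusions m' → e ≫ m = e' ≫ m' →
        ∃! i : I ≅ J, e ≫ i.hom = e' ∧ i.hom ≫ m' = m) ∧
    IsOrthogonalFactorizationSystem Q.covers Q.inclusions := by
  have tab : ∀ (A B : D.Obj) (f : A ⟶ B),
      (∃ (T : D.Obj) (τ : D.arr (D.unit T) ⟶ D.arr (Q.cokernelPro f)), D.IsTabulator τ) ∧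
      ∀ (T : D.Obj) (τ : D.arr (D.unit T) ⟶ D.arr (Q.cokernelPro f)), D.IsTabulator τ →
        D.srcMap τ = D.tgtMap τ ∧ Q.inclusions (D.srcMap τ) ∧
        ∃ e : A ⟶ T, D.unitMap e ≫ τ = Q.cokernelCell f ∧
          Q.covers e ∧ e ≫ D.srcMap τ = f := by
    intro A B f
    refine ⟨hTab.exists_isTabulator _, fun T τ hτ => ?_⟩
    have hlegs := DblCat.Equipment.srcMap_eq_tgtMap_of_cokernelPro hFull τ
    have hl : Q.inclusions (D.srcMap τ) := by
      have h := hJoint _ _ _ _ τ hτ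
      -- With equal legs the pairing is `l` followed by the diagonal, whose retraction allows it to
      -- be cancelled.
      rw [← hlegs, K.pair_self] at h
      obtain ⟨r, hr⟩ := K.exists_unit_app_comp B
      exact Q.inclusions_of_comp hr h
    obtain ⟨e, he, -⟩ := hτ A (Q.cokernelCell f)
    refine ⟨hlegs, hl, e, he,
      DblCat.Equipment.covers_of_unitMap_comp_eq hFull τ rfl hlegs.symm hl he, ?_⟩
    have h := Q.srcMap_cokernelCell f
    rwa [← he, D.srcMap_comp, D.srcMap_unitMap] at h
  have lift : ∀ {A B X Y : D.Obj} (e : A ⟶ X) (m : B ⟶ Y) (p : A ⟶ B) (q : X ⟶ Y),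
      Q.covers e → Q.inclusions m → p ≫ m = e ≫ q → ∃! d : X ⟶ B, e ≫ d = p ∧ d ≫ m = q :=
    fun e m p q he hm h => (hReg _ _ m hm).existsUnique_lift hFull he h
  refine ⟨tab, ?_, ?_⟩
  · intro A B I J e m e' m' he hm he' hm' h
    -- The two factorizations are compared by diagonals in both directions; all remaining identities
    -- hold because `m` and `m'` are monic.
    obtain ⟨d, ⟨-, hd⟩, -⟩ := lift e m' e' m he hm' h.symm
    obtain ⟨d', ⟨-, hd'⟩, -⟩ := lift e' m e m' he' hm h
    refine ⟨⟨d, d', hm.mono hFull ?_, hm'.mono hFull ?_⟩, ⟨hm'.mono hFull ?_, hd⟩, ?_⟩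
    · rw [Category.assoc, hd', hd, Category.id_comp]
    · rw [Category.assoc, hd, hd', Category.id_comp]
    · rw [Category.assoc, hd, h]
    · rintro i ⟨-, hi⟩
      exact Iso.ext (hm'.mono hFull (hi.trans hd.symm))
  · refine ⟨fun f _ => Q.covers_of_isIso f, fun f _ => Q.inclusions_of_isIso f,
      fun _ _ => Q.covers_comp, fun _ _ => Q.inclusions_comp, fun {A B} f => ?_, lift⟩
    obtain ⟨⟨T, τ, hτ⟩, H⟩ := tab A B f
    obtain ⟨-, hl, e, -, he, hf⟩ := H T τ hτ
    exact ⟨T, e, D.srcMap τ, he, hl, hf⟩
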